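/- **Theorem (stability of the semi-discrete formulation).** Let $d\in\{2,3\}$ and let $\Omega\subset\mathbb R^d$ be an open bounded convex domain with $\overline\Omega=\overline\Omega_e\cup\overline\Omega_a$, where $\Omega_e$ (elastic) and $\Omega_a$ (acoustic) are disjoint open bounded convex polytopic sets, $\Gamma_I=\partial\Omega_e\cap\partial\Omega_a$, and $\Gamma_I$, $\partial\Omega_e\setminus\Gamma_I$, $\partial\Omega_a\setminus\Gamma_I$ have positive surface measure. Let $\mathcal T_h=\mathcal T_h^e\cup\mathcal T_h^a$ be a finite mesh of $\Omega$ into disjoint open polytopic elements $\kappa$ of diameter $h_\kappa$, contained in $\overline\Omega_e$ or in $\overline\Omega_a$, whose boundaries are unions of nonoverlapping $(d-1)$-simplices (faces), each face either lying on $\partial\Omega$ and belonging to one element, or being shared by two elements. Let $\mathcal F_h^e$ (resp. $\mathcal F_h^a$) be the set of the faces of $\mathcal T_h^e$ (resp. $\mathcal T_h^a$) not on $\Gamma_I$. *Mesh assumption:* there is a constant $C_{\mathcal T}>0$ such that every $\kappa$ contains nonoverlapping $d$-simplices $\kappa_\flat^F$, one for each face $F\subset\partial\kappa$ and having $F$ as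 a face, with $h_\kappa\le C_{\mathcal T}\,d\,|\kappa_\flat^F|/|F|$ (no bound on the number or the size of the faces). Let $0<\rho_e^-\le\rho_e\le\rho_e^+<\infty$ a.e. in $\Omega_e$, $0\le\zeta\in L^\infty(\Omega)$, $c>0$ constant, $0<\rho_a^-\le\rho_a\le\rho_a^+<\infty$ element-wise constant, and $\mathbb C$ an element-wise constant, symmetric, uniformly elliptic fourth-order tensor. With degrees $p_\kappa\ge1$ let $\mathbf V_h^e$ (resp. $V_h^a$) be the space of vector-valued (resp. scalar) functions on $\Omega_e$ (resp. $\Omega_a$) that are polynomials of total degree at most $p_\kappa$ on each $\kappa\in\mathcal T_h^e$ (resp. $\kappa\in\mathcal T_h^a$). On a face shared by $\kappa^\pm$ with outer unit normals $\mathbf n^\pm$ put $[\![\psi]\!]=\psi^+\mathbf n^++\psi^-\mathbf n^-$, $[\![\mathbf v]\!]=\mathbf v^+\otimes\mathbf n^++\mathbf v^-\otimes\mathbf n^-$, $\{\!\{\cdot\}\!\}=\frac12((\cdot)^++(\cdot)^-)$, and on a boundary face $[\![\psi]\!]=\psi\mathbf n$, $[\![\mathbf v]\!]=\mathbf v\otimes\mathbf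 n$, $\{\!\{\cdot\}\!\}=(\cdot)$. For $\alpha,\beta>0$ put $$\eta_{|F}=\alpha\max_{\kappa}\frac{|\mathbb C^{1/2}_{|\kappa}|_2^2\,p_\kappa^2}{h_\kappa}\ (F\in\mathcal F_h^e),\qquad \chi_{|F}=\beta\max_{\kappa}\frac{\rho_{a|\kappa}\,p_\kappa^2}{h_\kappa}\ (F\in\mathcal F_h^a),$$ the maxima being over the one or two elements having $F$ as a face. Let $\boldsymbol\varepsilon_h(\mathbf v)$ be the element-wise symmetric gradient, $\nabla_h$ the element-wise gradient, $\boldsymbol\sigma_h=\mathbb C\boldsymbol\varepsilon_h$, $\langle\cdot,\cdot\rangle_{\mathcal F}=\sum_{F\in\mathcal F}(\cdot,\cdot)_F$, $\|\cdot\|_{\mathcal F}^2=\langle\cdot,\cdot\rangle_{\mathcal F}$, and $$\mathcal A_h^e(\mathbf u,\mathbf v)=(\boldsymbol\sigma_h(\mathbf u),\boldsymbol\varepsilon_h(\mathbf v))_{\Omega_e}-\langle\{\!\{\boldsymbol\sigma_h(\mathbf u)\}\!\},[\![\mathbf v]\!]\rangle_{\mathcal F_h^e}-\langle[\![\mathbf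 u]\!],\{\!\{\boldsymbol\sigma_h(\mathbf v)\}\!\}\rangle_{\mathcal F_h^e}+\langle\eta[\![\mathbf u]\!],[\![\mathbf v]\!]\rangle_{\mathcal F_h^e},$$ $$\mathcal A_h^a(\phi,\psi)=(\rho_a\nabla_h\phi,\nabla_h\psi)_{\Omega_a}-\langle\{\!\{\rho_a\nabla_h\phi\}\!\},[\![\psi]\!]\rangle_{\mathcal F_h^a}-\langle[\![\phi]\!],\{\!\{\rho_a\nabla_h\psi\}\!\}\rangle_{\mathcal F_h^a}+\langle\chi[\![\phi]\!],[\![\psi]\!]\rangle_{\mathcal F_h^a},$$ $$\mathcal I_h^e(\psi,\mathbf v)=(\rho_a\psi\mathbf n_e,\mathbf v)_{\Gamma_I},\qquad \mathcal I_h^a(\mathbf v,\psi)=(\rho_a\mathbf v\cdot\mathbf n_a,\psi)_{\Gamma_I},$$ where $\mathbf n_e,\mathbf n_a$ are the outer unit normals to $\Omega_e,\Omega_a$. Let $T>0$, $\mathbf f_e\in C^0([0,T];L^2(\Omega_e)^d)$, $f_a\in C^0([0,T];L^2(\Omega_a))$, and let $\mathbf U_h=(\mathbf u_h,\phi_h)\in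 C^2([0,T];\mathbf V_h^e)\times C^2([0,T];V_h^a)$ satisfy, for all $t\in(0,T]$ and all $(\mathbf v,\psi)\in\mathbf V_h^e\times V_h^a$, $$(\rho_e\ddot{\mathbf u}_h,\mathbf v)_{\Omega_e}+(c^{-2}\rho_a\ddot\phi_h,\psi)_{\Omega_a}+(2\rho_e\zeta\dot{\mathbf u}_h,\mathbf v)_{\Omega_e}+(\rho_e\zeta^2\mathbf u_h,\mathbf v)_{\Omega_e}+\mathcal A_h^e(\mathbf u_h,\mathbf v)+\mathcal A_h^a(\phi_h,\psi)+\mathcal I_h^e(\dot\phi_h,\mathbf v)+\mathcal I_h^a(\dot{\mathbf u}_h,\psi)=(\mathbf f_e,\mathbf v)_{\Omega_e}+(\rho_af_a,\psi)_{\Omega_a}.$$ Define the energy norm by $$\|\mathbf U_h\|_{\mathcal E}^2=\|\rho_e^{1/2}\dot{\mathbf u}_h\|_{\Omega_e}^2+\|\rho_e^{1/2}\zeta\mathbf u_h\|_{\Omega_e}^2+\|\mathbb C^{1/2}\boldsymbol\varepsilon_h(\mathbf u_h)\|_{\Omega_e}^2+\|\eta^{1/2}[\![\mathbf u_h]\!]\|_{\mathcal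 F_h^e}^2+\|c^{-1}\rho_a^{1/2}\dot\phi_h\|_{\Omega_a}^2+\|\rho_a^{1/2}\nabla_h\phi_h\|_{\Omega_a}^2+\|\chi^{1/2}[\![\phi_h]\!]\|_{\mathcal F_h^a}^2.$$ Then there are $\alpha_0,\beta_0>0$, depending only on $d$ and $C_{\mathcal T}$, such that for all $\alpha\ge\alpha_0$, $\beta\ge\beta_0$ and all $t\in(0,T]$ $$\|\mathbf U_h(t)\|_{\mathcal E}\le C\Big(\|\mathbf U_h(0)\|_{\mathcal E}+\int_0^t\big(\|\mathbf f_e(\tau)\|_{\Omega_e}+\|f_a(\tau)\|_{\Omega_a}\big)\,d\tau\Big),$$ where $C>0$ depends only on $d$, $C_{\mathcal T}$, a positive lower bound of $\rho_e$, and upper bounds of $\rho_a$ and $c$; in particular it is independent of the meshsize, the polynomial degrees, the number of faces per element, $\alpha$, $\beta$ and $T$. -/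

import Mathlib

open MeasureTheory Set Topology
open scoped Matrix MatrixOrder

noncomputable section

namespace ElastoAcoustic

/-- The Euclidean space `ℝ^d`. -/
abbrev E (d : ℕ) : Type := EuclideanSpace ℝ (Fin d)

/-! ### The continuous domain -/

/-- An open bounded convex domain `Ω` that is decomposed into two disjoint open bounded convex
subdomains, the elastic one `Ωe` and the acoustic one `Ωa`. (Bounded convex open sets are Lipschitz
domains.) The interface and the two Dirichlet boundaries have positive surface measure. -/
structure Domain (d : ℕ) where
  Ω : Set (E d)
  Ωe : Set (E d)
  Ωa : Set (E d)
  isOpen_Ω : IsOpen Ω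
  isOpen_Ωe : IsOpen Ωe
  isOpen_Ωa : IsOpen Ωa
  isBounded_Ω : Bornology.IsBounded Ω
  convex_Ω : Convex ℝ Ω
  convex_Ωe : Convex ℝ Ωe
  convex_Ωa : Convex ℝ Ωa
  disjoint : Disjoint Ωe Ωa
  closure_eq : closure Ω = closure Ωe ∪ closure Ωa
  interface_pos : 0 < μHE[d - 1] (frontier Ωe ∩ frontier Ωa)
  dirichlet_e_pos : 0 < μHE[d - 1] (frontier Ωe \ (frontier Ωe ∩ frontier Ωa))
  dirichlet_a_pos : 0 < μHE[d - 1] (frontier Ωa \ (frontier Ωe ∩ frontier Ωa))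

/-! ### Polytopic meshes -/

/-- `n` is the outer unit normal to the open set `K` along the flat piece of boundary given by the
simplex `F`: it is a unit vector, orthogonal to `F`, and at each point of the relative interior of
`F` it points from `K` to the outside of `K`. -/
structure IsOuterUnitNormal {d m : ℕ} (K : Set (E d)) (F : Affine.Simplex ℝ (E d) m) (n : E d) :
    Prop where
  norm_eq : ‖n‖ = 1
  orthogonal : ∀ i j, inner ℝ n (F.points i - F.points j) = 0
  outer : ∀ x ∈ F.interior, ∀ᶠ s in 𝓝[>] (0 : ℝ), x - s • n ∈ K ∧ x + s • n ∉ K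

/-- A polytopic mesh of `D.Ω`, compliant with the splitting into elastic and acoustic subdomains.
The elements are indexed by `Fin nE ⊕ Fin nA` (elastic and acoustic ones), the faces, which are
`(d-1)`-dimensional simplices, by `Fin nF`. -/
structure PolytopicMesh {d : ℕ} (D : Domain d) where
  nE : ℕ
  nA : ℕ
  nF : ℕ
  /-- The open elements. -/
  cell : Fin nE ⊕ Fin nA → Set (E d)
  /-- The faces. -/
  face : Fin nF → Affine.Simplex ℝ (E d) (d - 1)
  /-- The outer unit normal to an element along one of its faces. -/
  normal : Fin nE ⊕ Fin nA → Fin nF → E d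
  isOpen_cell : ∀ K, IsOpen (cell K)
  nonempty_cell : ∀ K, (cell K).Nonempty
  isBounded_cell : ∀ K, Bornology.IsBounded (cell K)
  /-- An element lies on one side of its boundary only. -/
  interior_closure_cell : ∀ K, interior (closure (cell K)) = cell K
  disjoint_cell : ∀ K L, K ≠ L → Disjoint (cell K) (cell L)
  cover : closure D.Ω = ⋃ K, closure (cell K)
  elastic_cell : ∀ K, closure (cell (Sum.inl K)) ⊆ closure D.Ωe
  acoustic_cell : ∀ K, closure (cell (Sum.inr K)) ⊆ closure D.Ωa
  /-- The boundary of an element is the union of the faces that it contains. -/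
  frontier_cell : ∀ K, frontier (cell K) =
    ⋃ F ∈ {F | (face F).closedInterior ⊆ frontier (cell K)}, (face F).closedInterior
  /-- Faces do not overlap. -/
  disjoint_face : ∀ F G, F ≠ G → Disjoint (face F).interior (face G).interior
  /-- A face either lies on the boundary of `Ω` and belongs to exactly one element, or it is shared
  by exactly two elements. -/
  face_adjacent : ∀ F,
    ((face F).closedInterior ⊆ frontier D.Ω ∧
      ∃ K, {L | (face F).closedInterior ⊆ frontier (cell L)} = {K}) ∨
    ∃ K K', K ≠ K' ∧ {L | (face F).closedInterior ⊆ frontier (cell L)} = {K, K'}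
  normal_spec : ∀ K F, (face F).closedInterior ⊆ frontier (cell K) →
    IsOuterUnitNormal (cell K) (face F) (normal K F)

namespace PolytopicMesh

variable {d : ℕ} {D : Domain d} (M : PolytopicMesh D)

/-- The diameter `h_κ` of an element. -/
def diam (K : Fin M.nE ⊕ Fin M.nA) : ℝ := Metric.diam (M.cell K)

/-- `F` is a face of the element `K`, that is `F ⊂ ∂K`. -/
def IsFaceOf (F : Fin M.nF) (K : Fin M.nE ⊕ Fin M.nA) : Prop :=
  (M.face F).closedInterior ⊆ frontier (M.cell K)

open Classical in
/-- The elastic elements having `F` as a face. -/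
def adjE (F : Fin M.nF) : Finset (Fin M.nE) := {K | M.IsFaceOf F (Sum.inl K)}

open Classical in
/-- The acoustic elements having `F` as a face. -/
def adjA (F : Fin M.nF) : Finset (Fin M.nA) := {K | M.IsFaceOf F (Sum.inr K)}

/-- The faces of elastic elements that do not lie on the interface (internal and boundary ones). -/
def facesE : Finset (Fin M.nF) := {F | (M.adjE F).Nonempty ∧ ¬ (M.adjA F).Nonempty}

/-- The faces of acoustic elements that do not lie on the interface (internal and boundary ones). -/
def facesA : Finset (Fin M.nF) := {F | (M.adjA F).Nonempty ∧ ¬ (M.adjE F).Nonempty}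

/-- The faces on the interface, shared by an elastic and an acoustic element. -/
def facesI : Finset (Fin M.nF) := {F | (M.adjE F).Nonempty ∧ (M.adjA F).Nonempty}

/-- The surface integral `∫_F g`, with respect to the `(d-1)`-dimensional surface measure. -/
def faceIntegral (F : Fin M.nF) (g : E d → ℝ) : ℝ :=
  ∫ x in (M.face F).closedInterior, g x ∂μHE[d - 1]

/-- The closed simplex with base the face `F` and opposite vertex `a`. -/
def cone (F : Fin M.nF) (a : E d) : Set (E d) :=
  convexHull ℝ (insert a (Set.range (M.face F).points))

/-- The mesh assumption, with constant `C`: in each element `K` there are nonoverlapping simplices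
`K_♭^F`, one for each face `F ⊂ ∂K` and having `F` as a face, such that
`h_K ≤ C d |K_♭^F| / |F|`. There is no restriction on the number or the size of the faces. -/
def Regular (C : ℝ) : Prop :=
  ∀ K, ∃ a : Fin M.nF → E d,
    (∀ F, M.IsFaceOf F K → M.cone F (a F) ⊆ closure (M.cell K)) ∧
    (∀ F G, M.IsFaceOf F K → M.IsFaceOf G K → F ≠ G →
      Disjoint (interior (M.cone F (a F))) (interior (M.cone G (a G)))) ∧
    ∀ F, M.IsFaceOf F K →
      M.diam K ≤ C * (d * (volume : Measure (E d)).real (M.cone F (a F)) /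
        (μHE[d - 1] : Measure (E d)).real (M.face F).closedInterior)

end PolytopicMesh

/-! ### Material data -/

/-- The material data. The fourth-order elasticity tensor `ℂ_{ijkl}` is stored as the matrix with
entries `C (i,j) (k,l)`; it and `ρ_a` are element-wise constant. -/
structure Material {d : ℕ} {D : Domain d} (M : PolytopicMesh D) where
  C : Fin M.nE → Matrix (Fin d × Fin d) (Fin d × Fin d) ℝ
  rhoE : E d → ℝ
  zeta : E d → ℝ
  rhoA : Fin M.nA → ℝ
  c : ℝ
  rhoEMin : ℝ
  rhoEMax : ℝ
  rhoAMin : ℝ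
  rhoAMax : ℝ
  C_major : ∀ K i j k l, C K (i, j) (k, l) = C K (k, l) (i, j)
  C_minor : ∀ K i j k l, C K (i, j) (k, l) = C K (j, i) (k, l)
  C_elliptic : ∃ c₀ > 0, ∀ K, ∀ τ : Fin d × Fin d → ℝ, (∀ i j, τ (i, j) = τ (j, i)) →
    c₀ * (τ ⬝ᵥ τ) ≤ τ ⬝ᵥ (C K *ᵥ τ)
  rhoE_meas : AEMeasurable rhoE (volume.restrict D.Ωe)
  rhoEMin_pos : 0 < rhoEMin
  rhoE_bounds : ∀ᵐ x ∂volume.restrict D.Ωe, rhoEMin ≤ rhoE x ∧ rhoE x ≤ rhoEMax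
  zeta_meas : AEMeasurable zeta (volume.restrict D.Ω)
  zeta_bounds : ∃ B, ∀ᵐ x ∂volume.restrict D.Ω, 0 ≤ zeta x ∧ zeta x ≤ B
  rhoAMin_pos : 0 < rhoAMin
  rhoA_bounds : ∀ K, rhoAMin ≤ rhoA K ∧ rhoA K ≤ rhoAMax
  c_pos : 0 < c

/-! ### Discrete spaces -/

/-- Polynomials in `d` variables of total degree at most `p`. -/
abbrev Poly (d p : ℕ) : Type := MvPolynomial.restrictTotalDegree (Fin d) ℝ p

/-- The value of a polynomial at a point. -/
def Poly.val {d p : ℕ} (q : Poly d p) (x : E d) : ℝ := MvPolynomial.eval x.ofLp q.1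

/-- The `i`-th partial derivative of a polynomial at a point. -/
def Poly.partialVal {d p : ℕ} (i : Fin d) (q : Poly d p) (x : E d) : ℝ :=
  MvPolynomial.eval x.ofLp (MvPolynomial.pderiv i q.1)

/-- The space `V_h^e` of vector-valued piecewise polynomials: one polynomial of degree at most
`p_κ` for each elastic element and each component (elements being open and nonempty, the
polynomials are determined by their restrictions to the elements). -/
abbrev VE {d : ℕ} {D : Domain d} (M : PolytopicMesh D) (pe : Fin M.nE → ℕ) : Type :=
  ∀ K : Fin M.nE, Fin d → Poly d (pe K)

/-- The space `V_h^a` of scalar piecewise polynomials on the acoustic mesh. -/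
abbrev VA {d : ℕ} {D : Domain d} (M : PolytopicMesh D) (pa : Fin M.nA → ℕ) : Type :=
  ∀ K : Fin M.nA, Poly d (pa K)

/-- The value of a vector-valued polynomial at a point. -/
def vecVal {d p : ℕ} (v : Fin d → Poly d p) (x : E d) : E d :=
  WithLp.toLp 2 fun i => (v i).val x

/-- The strain tensor `(∇v + ∇vᵀ)/2` of a vector-valued polynomial. -/
def strain {d p : ℕ} (v : Fin d → Poly d p) (x : E d) : Fin d × Fin d → ℝ :=
  fun ij => ((v ij.1).partialVal ij.2 x + (v ij.2).partialVal ij.1 x) / 2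

/-- The gradient of a polynomial. -/
def grad {d p : ℕ} (q : Poly d p) (x : E d) : E d :=
  WithLp.toLp 2 fun i => q.partialVal i x

/-! ### Bilinear forms and norms -/

section Forms

variable {d : ℕ} {D : Domain d} {M : PolytopicMesh D} {pe : Fin M.nE → ℕ} {pa : Fin M.nA → ℕ}

namespace Material

variable (mat : Material M)

/-- The positive square root `ℂ^{1/2}` of the elasticity tensor on an element. -/
def sqrtC (K : Fin M.nE) : Matrix (Fin d × Fin d) (Fin d × Fin d) ℝ := CFC.sqrt (mat.C K)

/-- `|ℂ^{1/2}|₂²` on an element, with the operator norm induced by the Euclidean norm. -/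
def Cbar (K : Fin M.nE) : ℝ := ‖Matrix.toEuclideanCLM (𝕜 := ℝ) (mat.sqrtC K)‖ ^ 2

/-- The stress `σ(v) = ℂ ε(v)` on an element. -/
def stress (K : Fin M.nE) {p : ℕ} (v : Fin d → Poly d p) (x : E d) : Fin d × Fin d → ℝ :=
  mat.C K *ᵥ strain v x

/-- The stabilization function `η` on an elastic face: `α` times the maximum of `ℂ̄_κ p_κ² / h_κ`
over the (one or two) elements having that face. -/
def eta (pe : Fin M.nE → ℕ) (α : ℝ) (F : Fin M.nF) : ℝ :=
  α * ⨆ K : M.adjE F, mat.Cbar K.1 * (pe K.1 : ℝ) ^ 2 / M.diam (Sum.inl K.1)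

/-- The stabilization function `χ` on an acoustic face: `β` times the maximum of
`ρ_{a,κ} p_κ² / h_κ` over the (one or two) elements having that face. -/
def chi (pa : Fin M.nA → ℕ) (β : ℝ) (F : Fin M.nF) : ℝ :=
  β * ⨆ K : M.adjA F, mat.rhoA K.1 * (pa K.1 : ℝ) ^ 2 / M.diam (Sum.inr K.1)

end Material

/-- The jump of `v` on an elastic face: `v⁺ ⊗ n⁺ + v⁻ ⊗ n⁻` on internal faces, `v ⊗ n` on boundary
faces. -/
def jumpE (v : VE M pe) (F : Fin M.nF) (x : E d) : Fin d × Fin d → ℝ :=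
  fun ij => ∑ K ∈ M.adjE F, (v K ij.1).val x * M.normal (Sum.inl K) F ij.2

/-- The average of `σ_h(v)` on an elastic face: the mean of the two traces on internal faces, the
trace itself on boundary faces. -/
def avgStress (mat : Material M) (v : VE M pe) (F : Fin M.nF) (x : E d) : Fin d × Fin d → ℝ :=
  ((M.adjE F).card : ℝ)⁻¹ • ∑ K ∈ M.adjE F, mat.stress K (v K) x

/-- The jump of `ψ` on an acoustic face: `ψ⁺ n⁺ + ψ⁻ n⁻` on internal faces, `ψ n` on boundary
faces. -/
def jumpA (ψ : VA M pa) (F : Fin M.nF) (x : E d) : E d :=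
  ∑ K ∈ M.adjA F, (ψ K).val x • M.normal (Sum.inr K) F

/-- The average of `ρ_a ∇_h ψ` on an acoustic face: the mean of the two traces on internal faces,
the trace itself on boundary faces. -/
def avgFlux (mat : Material M) (ψ : VA M pa) (F : Fin M.nF) (x : E d) : E d :=
  ((M.adjA F).card : ℝ)⁻¹ • ∑ K ∈ M.adjA F, mat.rhoA K • grad (ψ K) x

/-- The bilinear form `𝒜_h^e`. -/
def formAE (mat : Material M) (α : ℝ) (u v : VE M pe) : ℝ :=
  (∑ K, ∫ x in M.cell (Sum.inl K), mat.stress K (u K) x ⬝ᵥ strain (v K) x)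
  - (∑ F ∈ M.facesE, M.faceIntegral F fun x => avgStress mat u F x ⬝ᵥ jumpE v F x)
  - (∑ F ∈ M.facesE, M.faceIntegral F fun x => jumpE u F x ⬝ᵥ avgStress mat v F x)
  + ∑ F ∈ M.facesE, M.faceIntegral F fun x => mat.eta pe α F * (jumpE u F x ⬝ᵥ jumpE v F x)

/-- The bilinear form `𝒜_h^a`. -/
def formAA (mat : Material M) (β : ℝ) (φ ψ : VA M pa) : ℝ :=
  (∑ K, ∫ x in M.cell (Sum.inr K), inner ℝ (mat.rhoA K • grad (φ K) x) (grad (ψ K) x))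
  - (∑ F ∈ M.facesA, M.faceIntegral F fun x => inner ℝ (avgFlux mat φ F x) (jumpA ψ F x))
  - (∑ F ∈ M.facesA, M.faceIntegral F fun x => inner ℝ (jumpA φ F x) (avgFlux mat ψ F x))
  + ∑ F ∈ M.facesA, M.faceIntegral F fun x =>
      mat.chi pa β F * inner ℝ (jumpA φ F x) (jumpA ψ F x)

/-- The interface form `ℐ_h^e(ψ, v) = (ρ_a ψ n_e, v)_{Γ_I}`; the inner sums have one term each. -/
def formIE (mat : Material M) (ψ : VA M pa) (v : VE M pe) : ℝ :=
  ∑ F ∈ M.facesI, ∑ Ke ∈ M.adjE F, ∑ Ka ∈ M.adjA F, M.faceIntegral F fun x =>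
    inner ℝ ((mat.rhoA Ka * (ψ Ka).val x) • M.normal (Sum.inl Ke) F) (vecVal (v Ke) x)

/-- The interface form `ℐ_h^a(v, ψ) = (ρ_a v · n_a, ψ)_{Γ_I}`; the inner sums have one term each. -/
def formIA (mat : Material M) (v : VE M pe) (ψ : VA M pa) : ℝ :=
  ∑ F ∈ M.facesI, ∑ Ke ∈ M.adjE F, ∑ Ka ∈ M.adjA F, M.faceIntegral F fun x =>
    (mat.rhoA Ka * inner ℝ (vecVal (v Ke) x) (M.normal (Sum.inr Ka) F)) * (ψ Ka).val x

/-- The weighted product `(w u, v)_{Ω_e}`. -/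
def prodE (w : E d → ℝ) (u v : VE M pe) : ℝ :=
  ∑ K, ∫ x in M.cell (Sum.inl K), inner ℝ (w x • vecVal (u K) x) (vecVal (v K) x)

/-- The weighted product `(w φ, ψ)_{Ω_a}` with an element-wise constant weight. -/
def prodA (w : Fin M.nA → ℝ) (φ ψ : VA M pa) : ℝ :=
  ∑ K, ∫ x in M.cell (Sum.inr K), (w K * (φ K).val x) * (ψ K).val x

/-- The square of the norm `‖v‖_{dG,e}`. -/
def dGSqE (mat : Material M) (α : ℝ) (v : VE M pe) : ℝ :=
  (∑ K, ∫ x in M.cell (Sum.inl K),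
    (mat.sqrtC K *ᵥ strain (v K) x) ⬝ᵥ (mat.sqrtC K *ᵥ strain (v K) x))
  + ∑ F ∈ M.facesE, M.faceIntegral F fun x =>
      (Real.sqrt (mat.eta pe α F) • jumpE v F x) ⬝ᵥ (Real.sqrt (mat.eta pe α F) • jumpE v F x)

/-- The square of the norm `‖ψ‖_{dG,a}`. -/
def dGSqA (mat : Material M) (β : ℝ) (ψ : VA M pa) : ℝ :=
  (∑ K, ∫ x in M.cell (Sum.inr K), ‖Real.sqrt (mat.rhoA K) • grad (ψ K) x‖ ^ 2)
  + ∑ F ∈ M.facesA, M.faceIntegral F fun x => ‖Real.sqrt (mat.chi pa β F) • jumpA ψ F x‖ ^ 2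

/-- The square of the elastic energy norm; `v'` is the time derivative of `v`. -/
def energySqE (mat : Material M) (α : ℝ) (v v' : VE M pe) : ℝ :=
  (∑ K, ∫ x in M.cell (Sum.inl K), ‖Real.sqrt (mat.rhoE x) • vecVal (v' K) x‖ ^ 2)
  + (∑ K, ∫ x in M.cell (Sum.inl K),
      ‖(Real.sqrt (mat.rhoE x) * mat.zeta x) • vecVal (v K) x‖ ^ 2)
  + dGSqE mat α v

/-- The square of the acoustic energy norm; `ψ'` is the time derivative of `ψ`. -/
def energySqA (mat : Material M) (β : ℝ) (ψ ψ' : VA M pa) : ℝ :=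
  (∑ K, ∫ x in M.cell (Sum.inr K), (mat.c⁻¹ * Real.sqrt (mat.rhoA K) * (ψ' K).val x) ^ 2)
  + dGSqA mat β ψ

/-- The mesh-dependent energy norm of `(v, ψ)`, with time derivatives `(v', ψ')`. -/
def energyNorm (mat : Material M) (α β : ℝ) (v v' : VE M pe) (ψ ψ' : VA M pa) : ℝ :=
  Real.sqrt (energySqE mat α v v' + energySqA mat β ψ ψ')

/-! ### The semi-discrete problem -/

/-- `u` is of class `C²` on `[0,T]` with values in the (finite-dimensional) real vector space `V`,
with first and second derivatives `u'` and `u''`. Differentiability and continuity are tested with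
all linear functionals. -/
structure IsC2Path {V : Type*} [AddCommGroup V] [Module ℝ V] (T : ℝ) (u u' u'' : ℝ → V) :
    Prop where
  hasDeriv₁ : ∀ ℓ : V →ₗ[ℝ] ℝ, ∀ t ∈ Icc 0 T,
    HasDerivWithinAt (fun s => ℓ (u s)) (ℓ (u' t)) (Icc 0 T) t
  hasDeriv₂ : ∀ ℓ : V →ₗ[ℝ] ℝ, ∀ t ∈ Icc 0 T,
    HasDerivWithinAt (fun s => ℓ (u' s)) (ℓ (u'' t)) (Icc 0 T) t
  continuousOn : ∀ ℓ : V →ₗ[ℝ] ℝ, ContinuousOn (fun s => ℓ (u'' s)) (Icc 0 T)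

/-- `(u, φ)`, with time derivatives `u', u'', φ', φ''`, is a solution of the semi-discrete problem
on `[0,T]` with loads `fe` and `fa`. -/
structure IsSemidiscreteSolution (mat : Material M) (α β T : ℝ)
    (fe : ℝ → Lp (E d) 2 (volume.restrict D.Ωe)) (fa : ℝ → Lp ℝ 2 (volume.restrict D.Ωa))
    (u u' u'' : ℝ → VE M pe) (φ φ' φ'' : ℝ → VA M pa) : Prop where
  u_path : IsC2Path T u u' u''
  φ_path : IsC2Path T φ φ' φ''
  equation : ∀ t ∈ Ioc 0 T, ∀ (v : VE M pe) (ψ : VA M pa),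
    prodE mat.rhoE (u'' t) v
    + prodA (fun K => (mat.c ^ 2)⁻¹ * mat.rhoA K) (φ'' t) ψ
    + prodE (fun x => 2 * mat.rhoE x * mat.zeta x) (u' t) v
    + prodE (fun x => mat.rhoE x * mat.zeta x ^ 2) (u t) v
    + formAE mat α (u t) v + formAA mat β (φ t) ψ
    + formIE mat (φ' t) v + formIA mat (u' t) ψ
    = (∑ K, ∫ x in M.cell (Sum.inl K), inner ℝ (fe t x) (vecVal (v K) x))
      + ∑ K, ∫ x in M.cell (Sum.inr K), (mat.rhoA K * fa t x) * (ψ K).val x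

end Forms

end ElastoAcoustic

end

open ElastoAcoustic

open MeasureTheory Set Topology
open scoped Matrix MatrixOrder

namespace ElastoAcoustic
noncomputable section

/-! Testing the equation with the velocities `(u', φ')` turns the symmetric terms into half the time
derivative of `modifiedEnergy`. The interface terms cancel because `n_e = -n_a` on each interface
face (`formIE_add_formIA`), and the damping term is nonnegative because `ζ ≥ 0`. By Cauchy-Schwarz
(`load_E_le`, `load_A_le`) the loads are at most a data constant times `(‖f_e‖ + ‖f_a‖) √Y`, with
`Y` the modified energy. Hence `Y' ≤ 2 c g √Y`, and dividing by `2√Y` gives `√Y(t) ≤ √Y(0) + c ∫ g`,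
without exponential growth (`sqrt_le_of_deriv_le`).

The modified energy must then be compared with the energy norm. They differ only by the consistency
terms of `𝒜_h^e` and `𝒜_h^a`, which are at most half of the squared dG norm when `α` and `β` are
large (`Regular.consistency_le`). Young's inequality spends half of the penalty on the jumps. The
remaining face integrals of the fluxes are controlled by volume integrals through a trace-inverse
inequality.

The constant in that inequality must depend only on `d` and the mesh constant. On one simplex with
base `F` and apex `a`, integration in polar form about `a` reduces the claim to a bound of `r(1)²`
by the weighted integral of `r²` over `[0,1]`, along each segment from `a` to `F`. This is a Markov
inequality: an antiderivative of `s^m r²` is monotone, and among polynomials bounded by one on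
`[-1,1]` the Chebyshev polynomial `T_N` has the largest derivative at `1`, namely `N²`. Summed over
the faces of one element, the integrals over the simplices `κ_♭^F` add up to at most the integral
over the element, since these simplices do not overlap. The number of faces therefore never enters
(`Regular.sum_faceIntegral_sq_le`). -/

/-! ### An endpoint inverse inequality in one variable -/

/-- Every real polynomial has an antiderivative vanishing at zero. -/
theorem exists_antiderivative (q : Polynomial ℝ) :
    ∃ R : Polynomial ℝ, R.derivative = q ∧ R.natDegree ≤ q.natDegree + 1 ∧ R.eval 0 = 0 := by
  refine ⟨∑ k ∈ Finset.range (q.natDegree + 1),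
    Polynomial.C (q.coeff k / (k + 1)) * Polynomial.X ^ (k + 1), ?_, ?_, ?_⟩
  · conv_rhs => rw [q.as_sum_range_C_mul_X_pow]
    rw [Polynomial.derivative_sum]
    refine Finset.sum_congr rfl fun k _ => ?_
    have hk : (k : ℝ) + 1 ≠ 0 := by positivity
    rw [Polynomial.derivative_C_mul_X_pow]
    congr 2
    push_cast
    field_simp
  · refine Polynomial.natDegree_sum_le_of_forall_le _ _ fun k hk => ?_
    refine (Polynomial.natDegree_C_mul_X_pow_le _ _).trans ?_
    have := Finset.mem_range.1 hk
    omega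
  · simp [Polynomial.eval_finsetSum]

/-- A polynomial with values in `[0, b]` on `[0,1]` has derivative at most `N² b` at `1`. -/
theorem derivative_eval_one_le {R : Polynomial ℝ} {N : ℕ} {b : ℝ} (hN : R.natDegree ≤ N)
    (hb : 0 < b) (h : ∀ x ∈ Icc (0 : ℝ) 1, R.eval x ∈ Icc 0 b) :
    R.derivative.eval 1 ≤ (N : ℝ) ^ 2 * b := by
  set A : Polynomial ℝ := Polynomial.C (1 / 2) * Polynomial.X + Polynomial.C (1 / 2) with hA
  have hAd : A.natDegree ≤ 1 := Polynomial.natDegree_linear_le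
  -- Affine changes of variable and of value carry `[0,1]` to `[-1,1]` and `[0,b]` to `[-1,1]`. The
  -- chain rule gives `P'(1) = (2/b) (1/2) R'(1) = R'(1)/b`.
  set P : Polynomial ℝ := Polynomial.C (2 / b) * R.comp A - 1 with hP
  have hPdeg : P.natDegree ≤ N := by
    refine (Polynomial.natDegree_sub_le _ _).trans (max_le ?_ (by simp))
    refine (Polynomial.natDegree_C_mul_le _ _).trans ?_
    refine Polynomial.natDegree_comp_le.trans ?_
    calc R.natDegree * A.natDegree ≤ N * 1 := Nat.mul_le_mul hN hAd
      _ = N := mul_one N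
  have hbd : ∀ x ∈ Icc (-1 : ℝ) 1, |P.eval x| ≤ 1 := by
    intro x hx
    have hx' : x / 2 + 1 / 2 ∈ Icc (0 : ℝ) 1 := ⟨by linarith [hx.1], by linarith [hx.2]⟩
    have := h _ hx'
    have he : P.eval x = 2 * (R.eval (x / 2 + 1 / 2) / b) - 1 := by
      simp [hP, hA, Polynomial.eval_comp]
      ring_nf
    have h0 : 0 ≤ R.eval (x / 2 + 1 / 2) / b := div_nonneg this.1 hb.le
    have h1 : R.eval (x / 2 + 1 / 2) / b ≤ 1 := (div_le_one hb).2 this.2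
    rw [he, abs_le]
    constructor <;> linarith
  -- Extremality of the Chebyshev polynomial: `P'(1) ≤ T_N'(1) = N²`.
  have key := Polynomial.Chebyshev.eval_iterate_derivative_le_of_forall_abs_le_one
    (k := 1) (le_refl (1 : ℝ)) (Polynomial.degree_le_of_natDegree_le hPdeg) hbd
  have hT : ((Polynomial.derivative^[1]) (Polynomial.Chebyshev.T ℝ N)).eval 1 = (N : ℝ) ^ 2 := by
    simpa using Polynomial.Chebyshev.derivative_T_eval_one (R := ℝ) N
  have hd : ((Polynomial.derivative^[1]) P).eval 1 = R.derivative.eval 1 / b := by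
    simp [hP, hA, Polynomial.derivative_comp, Polynomial.eval_comp]
    norm_num
    field_simp
  rw [hT, hd, div_le_iff₀ hb] at key
  exact key

/-- The endpoint inverse inequality with the weight `s ^ m`. -/
theorem sq_eval_one_le (r : Polynomial ℝ) (m p : ℕ) (hr : r.natDegree ≤ p) :
    (r.eval 1) ^ 2 ≤ ((2 * p + m + 1 : ℕ) : ℝ) ^ 2 * ∫ s in (0 : ℝ)..1, s ^ m * (r.eval s) ^ 2 := by
  obtain ⟨R, hR, hRd, hR0⟩ := exists_antiderivative (Polynomial.X ^ m * r ^ 2)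
  have hdeg : R.natDegree ≤ 2 * p + m + 1 := by
    have h1 : (Polynomial.X ^ m * r ^ 2 : Polynomial ℝ).natDegree ≤ m + 2 * p := by
      refine Polynomial.natDegree_mul_le.trans ?_
      gcongr
      · exact Polynomial.natDegree_X_pow_le m
      · exact Polynomial.natDegree_pow_le.trans (Nat.mul_le_mul_left 2 hr)
    omega
  have hint : ∀ a b : ℝ, ∫ s in a..b, s ^ m * (r.eval s) ^ 2 = R.eval b - R.eval a := by
    intro a b
    refine intervalIntegral.integral_eq_sub_of_hasDerivAt (f := fun x => R.eval x)
      (fun x _ => ?_) (Continuous.intervalIntegrable (by fun_prop) _ _)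
    have := R.hasDerivAt x
    rw [hR] at this
    simpa using this
  -- Since `R` has a nonnegative derivative on `[0,1]` and vanishes at `0`, its values there lie in
  -- `[0, R(1)]`, and `R(1)` is the integral on the right-hand side.
  have hmono : ∀ a b : ℝ, 0 ≤ a → a ≤ b → R.eval a ≤ R.eval b := by
    intro a b ha hab
    have : 0 ≤ ∫ s in a..b, s ^ m * (r.eval s) ^ 2 := by
      refine intervalIntegral.integral_nonneg hab fun s hs => ?_
      have : 0 ≤ s := ha.trans hs.1
      positivity
    rw [hint] at this
    linarith
  have h1 : R.derivative.eval 1 = (r.eval 1) ^ 2 := by rw [hR]; simp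
  rw [hint 0 1, hR0, sub_zero, ← h1]
  refine le_of_forall_pos_le_add fun ε hε => ?_
  set N : ℝ := ((2 * p + m + 1 : ℕ) : ℝ)
  have hN : 0 < N ^ 2 := by positivity
  have hnn : 0 ≤ R.eval 1 := by simpa [hR0] using hmono 0 1 le_rfl zero_le_one
  -- The value `R(1)` may vanish, while the Markov bound needs a positive height. The excess `ε /
  -- N²` costs exactly `ε`.
  have := derivative_eval_one_le (R := R) (b := R.eval 1 + ε / N ^ 2) hdeg (by positivity)
    (fun x hx => ⟨by simpa [hR0] using hmono 0 x le_rfl hx.1,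
      (hmono x 1 hx.1 hx.2).trans (by simp; positivity)⟩)
  refine this.trans (le_of_eq ?_)
  change N ^ 2 * _ = _
  rw [mul_add, mul_div_cancel₀ _ hN.ne']

/-! ### Polynomial functions on Euclidean space -/

/-- `g` is a polynomial function of total degree at most `p`. -/
def IsPolyFun {d : ℕ} (p : ℕ) (g : E d → ℝ) : Prop :=
  ∃ q : MvPolynomial (Fin d) ℝ, q.totalDegree ≤ p ∧ ∀ x, g x = MvPolynomial.eval x.ofLp q

theorem IsPolyFun.continuous {d p : ℕ} {g : E d → ℝ} (hg : IsPolyFun p g) : Continuous g := by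
  obtain ⟨q, -, hq⟩ := hg
  rw [funext hq]
  exact q.continuous_eval.comp (by fun_prop)

theorem IsPolyFun.add {d p : ℕ} {f g : E d → ℝ} (hf : IsPolyFun p f) (hg : IsPolyFun p g) :
    IsPolyFun p (fun x => f x + g x) := by
  obtain ⟨q, hq, h⟩ := hf
  obtain ⟨r, hr, h'⟩ := hg
  exact ⟨q + r, (MvPolynomial.totalDegree_add _ _).trans (max_le hq hr), fun x => by simp [h, h']⟩

theorem IsPolyFun.const_mul {d p : ℕ} {f : E d → ℝ} (hf : IsPolyFun p f) (c : ℝ) :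
    IsPolyFun p (fun x => c * f x) := by
  obtain ⟨q, hq, h⟩ := hf
  refine ⟨MvPolynomial.C c * q, (MvPolynomial.totalDegree_mul _ _).trans ?_, fun x => by simp [h]⟩
  simpa using hq

theorem IsPolyFun.sum {d p : ℕ} {ι : Type*} (s : Finset ι) {f : ι → E d → ℝ}
    (hf : ∀ i, IsPolyFun p (f i)) : IsPolyFun p (fun x => ∑ i ∈ s, f i x) := by
  classical
  induction s using Finset.induction_on with
  | empty => exact ⟨0, by simp, by simp⟩
  | insert a s ha ih =>
    simp only [Finset.sum_insert ha]
    exact (hf a).add ih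

theorem Poly.isPolyFun_val {d p : ℕ} (q : Poly d p) : IsPolyFun p q.val :=
  ⟨q.1, (MvPolynomial.mem_restrictTotalDegree _ _ _).1 q.2, fun _ => rfl⟩

theorem totalDegree_pderiv_le {σ : Type*} [DecidableEq σ] (i : σ) (q : MvPolynomial σ ℝ) :
    (MvPolynomial.pderiv i q).totalDegree ≤ q.totalDegree := by
  conv_lhs => rw [q.as_sum, map_sum]
  refine MvPolynomial.totalDegree_finsetSum_le fun s hs => ?_
  rw [MvPolynomial.pderiv_monomial]
  refine (MvPolynomial.totalDegree_monomial_le _ _).trans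
    (le_trans ?_ (MvPolynomial.le_totalDegree hs))
  rw [Finsupp.sum_of_support_subset _ (Finsupp.support_mono tsub_le_self) _ (by simp)]
  exact Finset.sum_le_sum fun j _ => by simp

theorem Poly.isPolyFun_partialVal {d p : ℕ} (i : Fin d) (q : Poly d p) :
    IsPolyFun p (q.partialVal i) :=
  ⟨MvPolynomial.pderiv i q.1, (totalDegree_pderiv_le i q.1).trans
    ((MvPolynomial.mem_restrictTotalDegree _ _ _).1 q.2), fun _ => rfl⟩

/-- A polynomial function is a polynomial of at most the same degree along each line. -/
theorem IsPolyFun.exists_restrict_line {d p : ℕ} {g : E d → ℝ} (hg : IsPolyFun p g) (a v : E d) :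
    ∃ r : Polynomial ℝ, r.natDegree ≤ p ∧ ∀ s : ℝ, g (a + s • v) = r.eval s := by
  obtain ⟨q, hq, h⟩ := hg
  refine ⟨MvPolynomial.aeval (fun i => Polynomial.C (a i) + Polynomial.C (v i) * Polynomial.X) q,
    -- Substituting `a i + v i X` for the variables turns a monomial of total degree `k` into a
    -- univariate polynomial of degree at most `k`.
    ?_, fun s => ?_⟩
  · conv_lhs => rw [q.as_sum, map_sum]
    refine Polynomial.natDegree_sum_le_of_forall_le _ _ fun m hm => ?_
    rw [MvPolynomial.aeval_monomial, ← Polynomial.C_eq_algebraMap]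
    refine (Polynomial.natDegree_C_mul_le _ _).trans ?_
    refine (Polynomial.natDegree_prod_le _ _).trans ?_
    refine (Finset.sum_le_sum (g := fun i => m i) fun i _ => ?_).trans
      ((MvPolynomial.le_totalDegree hm).trans hq)
    refine Polynomial.natDegree_pow_le.trans ?_
    have : (Polynomial.C (a i) + Polynomial.C (v i) * Polynomial.X).natDegree ≤ 1 := by
      rw [add_comm]; exact Polynomial.natDegree_linear_le
    calc _ ≤ m i * 1 := Nat.mul_le_mul_left _ this
      _ = m i := mul_one _
  · rw [h, ← Polynomial.coe_evalRingHom, MvPolynomial.aeval_def, MvPolynomial.hom_eval₂,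
      ← MvPolynomial.coe_eval₂Hom]
    rw [MvPolynomial.eval, MvPolynomial.coe_eval₂Hom, MvPolynomial.coe_eval₂Hom]
    congr 1
    · ext x; simp
    · funext i
      simp only [Polynomial.coe_evalRingHom, Polynomial.eval_add,
        Polynomial.eval_mul, Polynomial.eval_C, Polynomial.eval_X]
      simp only [PiLp.add_apply, PiLp.smul_apply, smul_eq_mul, mul_comm]

/-- The endpoint inverse inequality along a segment, in terms of lower Lebesgue integrals. -/
theorem IsPolyFun.ofReal_sq_le {d p : ℕ} {g : E d → ℝ} (hg : IsPolyFun p g) (m : ℕ) (a y : E d) :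
    ENNReal.ofReal (g y ^ 2) ≤ ENNReal.ofReal (((2 * p + m + 1 : ℕ) : ℝ) ^ 2) *
      ∫⁻ s in Ioc (0 : ℝ) 1, ENNReal.ofReal (s ^ m) * ENNReal.ofReal (g (a + s • (y - a)) ^ 2) := by
  obtain ⟨r, hr, h⟩ := hg.exists_restrict_line a (y - a)
  have h1 : g y = r.eval 1 := by rw [← h 1]; simp
  have hint : IntegrableOn (fun s : ℝ => s ^ m * (r.eval s) ^ 2) (Ioc 0 1) :=
    (Continuous.integrableOn_Icc (by fun_prop)).mono_set Ioc_subset_Icc_self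
  have heq : ∫⁻ s in Ioc (0 : ℝ) 1, ENNReal.ofReal (s ^ m) *
      ENNReal.ofReal (g (a + s • (y - a)) ^ 2)
      = ENNReal.ofReal (∫ s in (0 : ℝ)..1, s ^ m * (r.eval s) ^ 2) := by
    rw [intervalIntegral.integral_of_le zero_le_one, ofReal_integral_eq_lintegral_ofReal hint]
    · refine setLIntegral_congr_fun measurableSet_Ioc fun s hs => ?_
      rw [← ENNReal.ofReal_mul (pow_nonneg hs.1.le m), h]
    · filter_upwards [ae_restrict_mem measurableSet_Ioc] with s hs
      have : 0 ≤ s := hs.1.le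
      positivity
  rw [heq, ← ENNReal.ofReal_mul (by positivity), h1]
  exact ENNReal.ofReal_le_ofReal (sq_eval_one_le r m p hr)


/-! ### The surface and volume measures of a cone over a simplex -/

/-- The linear part of the standard parametrization of a simplex. -/
def edgeMap {d m : ℕ} (F : Affine.Simplex ℝ (E d) m) : (Fin m → ℝ) →ₗ[ℝ] E d :=
  Fintype.linearCombination ℝ fun i => F.points i.succ - F.points 0

/-- The standard parametrization of a simplex. -/
def faceParam {d m : ℕ} (F : Affine.Simplex ℝ (E d) m) (l : Fin m → ℝ) : E d :=
  F.points 0 + edgeMap F l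

/-- The reference simplex. -/
def refSimplex (m : ℕ) : Set (Fin m → ℝ) := {l | (∀ i, 0 ≤ l i) ∧ ∑ i, l i ≤ 1}

theorem measurableSet_refSimplex (m : ℕ) : MeasurableSet (refSimplex m) := by
  have h : IsClosed ({l | ∀ i, 0 ≤ l i} ∩ {l | ∑ i, l i ≤ 1} : Set (Fin m → ℝ)) :=
    (isClosed_Ici (a := (0 : Fin m → ℝ))).inter (isClosed_le (by fun_prop) continuous_const)
  exact h.measurableSet

theorem injective_edgeMap {d m : ℕ} (F : Affine.Simplex ℝ (E d) m) :
    Function.Injective (edgeMap F) := by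
  have h := (affineIndependent_iff_linearIndependent_vsub ℝ F.points 0).1 F.independent
  have h' : LinearIndependent ℝ fun i : Fin m => F.points i.succ - F.points 0 :=
    h.comp (fun i : Fin m => (⟨i.succ, Fin.succ_ne_zero i⟩ : {x // x ≠ (0 : Fin (m + 1))}))
      fun i j hij => by simpa using hij
  exact h'.fintypeLinearCombination_injective

theorem closedInterior_eq_image {d m : ℕ} (F : Affine.Simplex ℝ (E d) m) :
    F.closedInterior = faceParam F '' refSimplex m := by
  have hcomb : ∀ w : Fin (m + 1) → ℝ, ∑ i, w i = 1 →
      Finset.univ.affineCombination ℝ F.points w = faceParam F (fun i => w i.succ) := by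
    intro w hw
    rw [Finset.affineCombination_eq_linear_combination _ _ _ hw, faceParam, edgeMap,
      Fintype.linearCombination_apply, Fin.sum_univ_succ]
    rw [Fin.sum_univ_succ] at hw
    have h0 : w 0 = 1 - ∑ i : Fin m, w i.succ := by linarith
    rw [h0]
    simp only [smul_sub, Finset.sum_sub_distrib, sub_smul, one_smul, Finset.sum_smul]
    abel
  ext x
  constructor
  · rintro ⟨w, hw, hI, rfl⟩
    refine ⟨fun i => w i.succ, ⟨fun i => (hI _).1, ?_⟩, (hcomb w hw).symm⟩
    rw [Fin.sum_univ_succ] at hw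
    have := (hI 0).1
    linarith
  · rintro ⟨l, ⟨h0, h1⟩, rfl⟩
    set w : Fin (m + 1) → ℝ := Fin.cons (1 - ∑ i, l i) l with hwdef
    have hw : ∑ i, w i = 1 := by rw [Fin.sum_univ_succ]; simp [hwdef]
    have hnn : ∀ i, 0 ≤ w i := by
      intro i
      refine Fin.cases ?_ (fun j => ?_) i
      · simp [hwdef, h1]
      · simp [hwdef, h0 j]
    refine ⟨w, hw, fun i => ⟨hnn i, ?_⟩, ?_⟩
    · rw [← hw]
      exact Finset.single_le_sum (fun j _ => hnn j) (Finset.mem_univ i)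
    · rw [hcomb w hw]
      simp [hwdef]

theorem continuous_faceParam {d m : ℕ} (F : Affine.Simplex ℝ (E d) m) :
    Continuous (faceParam F) :=
  continuous_const.add (LinearMap.continuous_of_finiteDimensional _)

/-- The surface integral over a simplex in terms of the standard parametrization. -/
theorem exists_lintegral_face {d m : ℕ} (F : Affine.Simplex ℝ (E d) m) :
    ∃ c : ENNReal, ∀ f : E d → ENNReal, Measurable f →
      ∫⁻ x in F.closedInterior, f x ∂μHE[m] = c * ∫⁻ l in refSimplex m, f (faceParam F l) := by
  have hinj := injective_edgeMap F
  set R := LinearMap.range (edgeMap F)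
  have hfin : Module.finrank ℝ R = m := by
    rw [LinearMap.finrank_range_of_inj hinj]; simp
  let e : (Fin m → ℝ) ≃ₗ[ℝ] R := LinearEquiv.ofInjective (edgeMap F) hinj
  let e' : (Fin m → ℝ) ≃L[ℝ] R := e.toContinuousLinearEquiv
  have : (μHE[m] : Measure R).IsAddHaarMeasure := by
    have h := MeasureTheory.isAddHaarMeasure_euclideanHausdorffMeasure (E := R)
    rwa [hfin] at h
  have : (Measure.map e' (volume : Measure (Fin m → ℝ))).IsAddHaarMeasure :=
    e'.isAddHaarMeasure_map _
  -- Both measures are Haar measures on the direction space of the face, hence proportional. The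
  -- factor is never computed: it cancels in the trace-inverse inequality.
  obtain ⟨c, hc⟩ : ∃ c : ENNReal, (μHE[m] : Measure R) = c • Measure.map e' volume :=
    ⟨_, Measure.isAddLeftInvariant_eq_smul _ _⟩
  let j : R → E d := fun v => F.points 0 + (v : E d)
  have hj : Isometry j := (isometry_add_left (F.points 0)).comp isometry_subtype_coe
  have hje : ∀ l, j (e' l) = faceParam F l := fun l => rfl
  have hmap := hj.map_euclideanHausdorffMeasure (d := m)
  have hφ : Measurable (faceParam F) := (continuous_faceParam F).measurable
  have hmap' : (μHE[m] : Measure (E d)).restrict (range j) =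
      c • Measure.map (faceParam F) volume := by
    rw [← hmap, hc, Measure.map_smul, Measure.map_map hj.continuous.measurable
      e'.continuous.measurable]
    rfl
  have hsub : F.closedInterior ⊆ range j := by
    rw [closedInterior_eq_image]
    rintro _ ⟨l, -, rfl⟩
    exact ⟨e' l, hje l⟩
  have hFm : MeasurableSet F.closedInterior := F.isClosed_closedInterior.measurableSet
  have hφinj : Function.Injective (faceParam F) := fun x y h => hinj (add_left_cancel h)
  refine ⟨c, fun f hf => ?_⟩
  rw [← Measure.restrict_restrict_of_subset hsub, hmap', Measure.restrict_smul,
    lintegral_smul_measure, Measure.restrict_map hφ hFm, lintegral_map hf hφ,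
    closedInterior_eq_image, preimage_image_eq _ hφinj]
  rfl

/-- The parametrization of the cone with apex `a` (at the origin) over a simplex. -/
def coneMap {d m : ℕ} (F : Affine.Simplex ℝ (E d) m) (a : E d) : ℝ × (Fin m → ℝ) →ₗ[ℝ] E d :=
  (LinearMap.toSpanSingleton ℝ (E d) (F.points 0 - a)).coprod (edgeMap F)

theorem add_coneMap {d m : ℕ} (F : Affine.Simplex ℝ (E d) m) (a : E d) (s : ℝ) (l : Fin m → ℝ) :
    a + coneMap F a (s, s • l) = a + s • (faceParam F l - a) := by
  simp only [coneMap, LinearMap.coprod_apply, LinearMap.toSpanSingleton_apply, map_smul, faceParam]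
  module

theorem mem_cone_iff {d m : ℕ} (F : Affine.Simplex ℝ (E d) m) (a x : E d) :
    x ∈ convexHull ℝ (insert a (range F.points)) ↔
      ∃ s ∈ Icc (0 : ℝ) 1, ∃ l ∈ refSimplex m, x = a + coneMap F a (s, s • l) := by
  rw [convexHull_insert (range_nonempty _), Affine.Simplex.convexHull_eq_closedInterior,
    closedInterior_eq_image]
  simp only [mem_convexJoin, mem_singleton_iff, exists_eq_left, segment_eq_image', mem_image, add_coneMap]
  constructor
  · rintro ⟨_, ⟨l, hl, rfl⟩, s, hs, rfl⟩
    exact ⟨s, hs, l, hl, rfl⟩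
  · rintro ⟨s, hs, l, hl, rfl⟩
    exact ⟨_, ⟨l, hl, rfl⟩, s, hs, rfl⟩

theorem isClosed_cone {d m : ℕ} (F : Affine.Simplex ℝ (E d) m) (a : E d) :
    IsClosed (convexHull ℝ (insert a (range F.points))) :=
  (((finite_range _).insert a).isCompact_convexHull (𝕜 := ℝ)).isClosed

/-- The volume integral over the cone with apex `a` over a simplex, in polar form. -/
theorem exists_lintegral_cone {m : ℕ} (F : Affine.Simplex ℝ (E (m + 1)) m) (a : E (m + 1)) :
    ∃ c : ENNReal, ∀ g : E (m + 1) → ENNReal, Measurable g →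
      ∫⁻ x in convexHull ℝ (insert a (range F.points)), g x =
        c * ∫⁻ l in refSimplex m, ∫⁻ s in Ioc (0 : ℝ) 1,
          ENNReal.ofReal (s ^ m) * g (a + s • (faceParam F l - a)) := by
  set S := convexHull ℝ (insert a (range F.points)) with hS
  have hSm : MeasurableSet S := (isClosed_cone F a).measurableSet
  by_cases hinj : Function.Injective (coneMap F a)
  swap
  -- A degenerate cone, with apex in the affine span of the face, is contained in a translate of a
  -- proper subspace and has measure zero.
  · refine ⟨0, fun g _ => ?_⟩
    rw [zero_mul]
    refine setLIntegral_measure_zero _ _ ?_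
    have hR : LinearMap.range (coneMap F a) ≠ ⊤ := by
      intro htop
      refine hinj ((LinearMap.injective_iff_surjective_of_finrank_eq_finrank ?_).2
        (LinearMap.range_eq_top.1 htop))
      simp [add_comm]
    have h0 := Measure.addHaar_submodule (volume : Measure (E (m + 1))) _ hR
    have hsub : S ⊆ (fun x => -a + x) ⁻¹' (LinearMap.range (coneMap F a) : Set (E (m + 1))) := by
      intro x hx
      obtain ⟨s, -, l, -, rfl⟩ := (mem_cone_iff F a x).1 hx
      simp
    refine measure_mono_null hsub ?_
    rw [measure_preimage_add]
    exact h0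
  let e : (ℝ × (Fin m → ℝ)) ≃ₗ[ℝ] E (m + 1) :=
    LinearEquiv.ofInjectiveOfFinrankEq (coneMap F a) hinj (by simp [add_comm])
  let e' : (ℝ × (Fin m → ℝ)) ≃L[ℝ] E (m + 1) := e.toContinuousLinearEquiv
  have hee : ∀ z, e' z = coneMap F a z := fun z => rfl
  have : (volume : Measure (ℝ × (Fin m → ℝ))).IsAddHaarMeasure := by
    rw [Measure.volume_eq_prod]; infer_instance
  have : (Measure.map e' (volume : Measure (ℝ × (Fin m → ℝ)))).IsAddHaarMeasure :=
    e'.isAddHaarMeasure_map _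
  obtain ⟨c, hc⟩ : ∃ c : ENNReal, (volume : Measure (E (m + 1))) = c • Measure.map e' volume :=
    ⟨_, Measure.isAddLeftInvariant_eq_smul _ _⟩
  refine ⟨c, fun g hg => ?_⟩
  have hψ : Measurable fun z => a + e' z := (continuous_const.add e'.continuous).measurable
  have hind : Measurable (S.indicator g) := hg.indicator hSm
  have h1 : ∫⁻ x in S, g x = c * ∫⁻ z, S.indicator g (a + e' z) := by
    rw [← lintegral_indicator hSm, ← lintegral_add_left_eq_self _ a]
    conv_lhs => rw [hc]
    rw [lintegral_smul_measure, lintegral_map (f := fun x => S.indicator g (a + x)) (hind.comp (measurable_const_add a))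
      e'.continuous.measurable]
    rfl
  have h2 : ∫⁻ z, S.indicator g (a + e' z) =
      ∫⁻ s : ℝ, ∫⁻ v : Fin m → ℝ, S.indicator g (a + e' (s, v)) := by
    rw [Measure.volume_eq_prod, lintegral_prod]
    exact (hind.comp hψ).aemeasurable
  -- Away from the apex the polar coordinates `(s, l)` are unique. The slice `s = 0` is null and can
  -- be discarded.
  have hmem : ∀ s : ℝ, s ≠ 0 → ∀ l, a + e' (s, s • l) ∈ S ↔ s ∈ Ioc (0 : ℝ) 1 ∧ l ∈ refSimplex m := by
    intro s hs l
    rw [hS, mem_cone_iff]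
    constructor
    · rintro ⟨s', hs', l', hl', h⟩
      have h' := hinj (add_left_cancel h)
      obtain ⟨rfl, h3⟩ := Prod.mk.inj h'
      have := smul_right_injective _ hs h3
      subst this
      exact ⟨⟨lt_of_le_of_ne hs'.1 hs.symm, hs'.2⟩, hl'⟩
    · rintro ⟨hs', hl⟩
      exact ⟨s, Ioc_subset_Icc_self hs', l, hl, rfl⟩
  -- The substitution `v = s • l` in the slice at height `s` produces the Jacobian `s ^ m`.
  have hscale : ∀ s : ℝ, 0 < s → ∀ h : (Fin m → ℝ) → ENNReal, Measurable h →
      ∫⁻ v, h v = ENNReal.ofReal (s ^ m) * ∫⁻ l, h (s • l) := by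
    intro s hs h hh
    have h3 := Measure.map_addHaar_smul (volume : Measure (Fin m → ℝ)) hs.ne'
    have h4 : ∫⁻ l, h (s • l) = ENNReal.ofReal |(s ^ m)⁻¹| * ∫⁻ v, h v := by
      rw [← lintegral_map (f := h) (g := fun l : Fin m → ℝ => s • l) hh (measurable_const_smul s)]
      rw [h3, lintegral_smul_measure]
      simp
    have hpos : 0 < s ^ m := pow_pos hs m
    rw [h4, ← mul_assoc, ← ENNReal.ofReal_mul hpos.le, abs_of_pos (inv_pos.2 hpos),
      mul_inv_cancel₀ hpos.ne', ENNReal.ofReal_one, one_mul]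
  have h3 : ∫⁻ s : ℝ, ∫⁻ v : Fin m → ℝ, S.indicator g (a + e' (s, v)) =
      ∫⁻ s in Ioc (0 : ℝ) 1, ∫⁻ l in refSimplex m,
        ENNReal.ofReal (s ^ m) * g (a + s • (faceParam F l - a)) := by
    rw [← lintegral_indicator measurableSet_Ioc]
    refine lintegral_congr_ae ?_
    have : ∀ᵐ s : ℝ, s ≠ 0 := by simp [ae_iff]
    filter_upwards [this] with s hs
    have hms : Measurable fun v : Fin m → ℝ => S.indicator g (a + e' (s, v)) :=
      (hind.comp hψ).comp measurable_prodMk_left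
    by_cases hs1 : s ∈ Ioc (0 : ℝ) 1
    · rw [indicator_of_mem hs1, hscale s hs1.1 _ hms, ← lintegral_const_mul _ (by
        exact hms.comp (measurable_const_smul s)),
        ← lintegral_indicator (measurableSet_refSimplex m)]
      refine lintegral_congr fun l => ?_
      by_cases hl : l ∈ refSimplex m
      · rw [indicator_of_mem ((hmem s hs l).2 ⟨hs1, hl⟩), indicator_of_mem hl, hee, add_coneMap]
      · rw [indicator_of_notMem (fun h => hl ((hmem s hs l).1 h).2), indicator_of_notMem hl,
          mul_zero]
    · rw [indicator_of_notMem hs1]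
      refine (lintegral_congr fun v => ?_).trans lintegral_zero
      have : v = s • (s⁻¹ • v) := by rw [smul_smul, mul_inv_cancel₀ hs, one_smul]
      rw [this]
      exact indicator_of_notMem (fun h => hs1 ((hmem s hs _).1 h).1) _
  rw [h1, h2, h3, lintegral_lintegral_swap]
  refine Measurable.aemeasurable ?_
  have h5 : Continuous fun z : ℝ × (Fin m → ℝ) => a + z.1 • (faceParam F z.2 - a) := by
    have := continuous_faceParam F
    fun_prop
  exact (by fun_prop : Measurable fun z : ℝ × (Fin m → ℝ) => ENNReal.ofReal (z.1 ^ m)).mul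
    (hg.comp h5.measurable)

/-- The trace-inverse inequality: the mean square of a polynomial on a face is bounded by its mean
square on any simplex having that face. -/
theorem IsPolyFun.trace_inverse {m p : ℕ} {g : E (m + 1) → ℝ} (hg : IsPolyFun p g)
    (F : Affine.Simplex ℝ (E (m + 1)) m) (a : E (m + 1)) :
    (∫⁻ x in F.closedInterior, ENNReal.ofReal (g x ^ 2) ∂μHE[m]) *
        volume (convexHull ℝ (insert a (range F.points))) ≤
      ENNReal.ofReal (((2 * p + m + 1 : ℕ) : ℝ) ^ 2) * μHE[m] F.closedInterior *
        ∫⁻ x in convexHull ℝ (insert a (range F.points)), ENNReal.ofReal (g x ^ 2) := by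
  obtain ⟨c₂, h₂⟩ := exists_lintegral_face F
  obtain ⟨c₁, h₁⟩ := exists_lintegral_cone F a
  have hgm : Measurable fun x => ENNReal.ofReal (g x ^ 2) :=
    (hg.continuous.measurable.pow_const 2).ennreal_ofReal
  have hF : μHE[m] F.closedInterior = c₂ * volume (refSimplex m) := by
    have := h₂ (fun _ => 1) measurable_const
    simpa using this
  -- The exact volume carries a further factor `∫ s^m ds = 1/(m+1)`. Bounding `s^m` by one loses
  -- only a factor `d`, which is allowed in the final constant.
  have hV : volume (convexHull ℝ (insert a (range F.points))) ≤ c₁ * volume (refSimplex m) := by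
    have := h₁ (fun _ => 1) measurable_const
    rw [setLIntegral_one] at this
    rw [this]
    gcongr
    rw [← setLIntegral_one]
    refine lintegral_mono fun l => ?_
    calc ∫⁻ s in Ioc (0 : ℝ) 1, ENNReal.ofReal (s ^ m) * 1 ≤ ∫⁻ s in Ioc (0 : ℝ) 1, 1 := by
          refine setLIntegral_mono measurable_const fun s hs => ?_
          rw [mul_one]
          exact ENNReal.ofReal_le_one.2 (pow_le_one₀ hs.1.le hs.2)
      _ = 1 := by simp
  rw [h₂ _ hgm, h₁ _ hgm, hF]
  set N := ENNReal.ofReal (((2 * p + m + 1 : ℕ) : ℝ) ^ 2)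
  have hle : ∫⁻ l in refSimplex m, ENNReal.ofReal (g (faceParam F l) ^ 2) ≤
      N * ∫⁻ l in refSimplex m, ∫⁻ s in Ioc (0 : ℝ) 1,
        ENNReal.ofReal (s ^ m) * ENNReal.ofReal (g (a + s • (faceParam F l - a)) ^ 2) := by
    rw [← lintegral_const_mul' _ _ ENNReal.ofReal_ne_top]
    exact lintegral_mono fun l => hg.ofReal_sq_le m a (faceParam F l)
  calc _ ≤ (c₂ * (N * ∫⁻ l in refSimplex m, ∫⁻ s in Ioc (0 : ℝ) 1,
        ENNReal.ofReal (s ^ m) * ENNReal.ofReal (g (a + s • (faceParam F l - a)) ^ 2))) *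
        (c₁ * volume (refSimplex m)) := by gcongr
    _ = _ := by ring


/-! ### Geometry of polytopic meshes -/

namespace PolytopicMesh

variable {d : ℕ} {D : Domain d} (M : PolytopicMesh D)

theorem integrableOn_cell {g : E d → ℝ} (hg : Continuous g) (K : Fin M.nE ⊕ Fin M.nA) :
    IntegrableOn g (M.cell K) :=
  (hg.continuousOn.integrableOn_compact (M.isBounded_cell K).isCompact_closure).mono_set
    subset_closure

theorem diam_pos (hd : 1 ≤ d) (K : Fin M.nE ⊕ Fin M.nA) : 0 < M.diam K := by
  have : Nonempty (Fin d) := ⟨⟨0, hd⟩⟩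
  obtain ⟨x, hx⟩ := M.nonempty_cell K
  have hinf : (M.cell K).Infinite := infinite_of_mem_nhds x ((M.isOpen_cell K).mem_nhds hx)
  exact Metric.diam_pos hinf.nontrivial (M.isBounded_cell K)

variable {M}

/-- If the real-valued measure of the face were zero, division by zero would make the right-hand
side of the mesh assumption vanish, although the diameter is positive. -/
theorem Regular.face_measure_pos {C : ℝ} (hR : M.Regular C) (hd : 1 ≤ d) {F : Fin M.nF}
    {K : Fin M.nE ⊕ Fin M.nA} (hF : M.IsFaceOf F K) :
    0 < (μHE[d - 1] : Measure (E d)).real (M.face F).closedInterior := by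
  obtain ⟨a, -, -, h⟩ := hR K
  have h1 := (M.diam_pos hd K).trans_le (h F hF)
  refine lt_of_le_of_ne measureReal_nonneg fun h0 => ?_
  rw [← h0] at h1
  simp at h1

/-- An infinite measure has real value `0`, so finiteness also follows from
`Regular.face_measure_pos`. -/
theorem Regular.face_measure_ne_top {C : ℝ} (hR : M.Regular C) (hd : 1 ≤ d) (F : Fin M.nF) :
    (μHE[d - 1] : Measure (E d)) (M.face F).closedInterior ≠ ⊤ := by
  obtain ⟨K, hK⟩ : ∃ K, M.IsFaceOf F K := by
    rcases M.face_adjacent F with ⟨-, K, hK⟩ | ⟨K, K', -, hK⟩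
    · exact ⟨K, hK.symm.subset (mem_singleton K)⟩
    · exact ⟨K, hK.symm.subset (mem_insert K _)⟩
  have := hR.face_measure_pos hd hK
  intro htop
  simp [Measure.real, htop] at this

theorem Regular.integrableOn_face {C : ℝ} (hR : M.Regular C) (hd : 1 ≤ d) (F : Fin M.nF)
    {g : E d → ℝ} (hg : Continuous g) :
    IntegrableOn g (M.face F).closedInterior μHE[d - 1] := by
  have hcpt := (M.face F).isCompact_closedInterior
  obtain ⟨B, hB⟩ := hcpt.exists_bound_of_continuousOn hg.continuousOn
  refine IntegrableOn.of_bound (hR.face_measure_ne_top hd F).lt_top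
    hg.aestronglyMeasurable B ?_
  filter_upwards [ae_restrict_mem hcpt.isClosed.measurableSet] with x hx using hB x hx

theorem isCompact_cone (F : Fin M.nF) (a : E d) : IsCompact (M.cone F a) :=
  ((finite_range _).insert a).isCompact_convexHull (𝕜 := ℝ)

/-- The trace-inverse inequality on a simplex `κ_♭^F`. -/
theorem faceIntegral_sq_mul_le {C : ℝ} (hR : M.Regular C) (hd : 1 ≤ d) {p : ℕ} {g : E d → ℝ}
    (hg : IsPolyFun p g) (F : Fin M.nF) (a : E d) :
    M.faceIntegral F (fun x => g x ^ 2) * (volume : Measure (E d)).real (M.cone F a) ≤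
      ((2 * p + d : ℕ) : ℝ) ^ 2 *
        (μHE[d - 1] : Measure (E d)).real (M.face F).closedInterior *
        ∫ x in M.cone F a, g x ^ 2 := by
  have hc : Continuous fun x => g x ^ 2 := hg.continuous.pow 2
  have hfin := hR.face_measure_ne_top hd F
  have hint : IntegrableOn (fun x => g x ^ 2) (M.cone F a) :=
    hc.continuousOn.integrableOn_compact (isCompact_cone F a)
  obtain ⟨m, rfl⟩ : ∃ m, d = m + 1 := ⟨d - 1, by omega⟩
  have h := hg.trace_inverse (M.face F) a
  have h1 : M.faceIntegral F (fun x => g x ^ 2) =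
      (∫⁻ x in (M.face F).closedInterior, ENNReal.ofReal (g x ^ 2) ∂μHE[m]).toReal :=
    integral_eq_lintegral_of_nonneg_ae (ae_of_all _ fun x => sq_nonneg _)
      hc.aestronglyMeasurable
  have h2 : ∫ x in M.cone F a, g x ^ 2 =
      (∫⁻ x in M.cone F a, ENNReal.ofReal (g x ^ 2)).toReal :=
    integral_eq_lintegral_of_nonneg_ae (ae_of_all _ fun x => sq_nonneg _)
      hc.aestronglyMeasurable
  have h3 : ∫⁻ x in M.cone F a, ENNReal.ofReal (g x ^ 2) ≠ ⊤ := by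
    rw [← ofReal_integral_eq_lintegral_ofReal hint (ae_of_all _ fun x => sq_nonneg _)]
    exact ENNReal.ofReal_ne_top
  have h4 := ENNReal.toReal_mono
    (ENNReal.mul_ne_top (ENNReal.mul_ne_top ENNReal.ofReal_ne_top hfin) h3) h
  rw [ENNReal.toReal_mul, ENNReal.toReal_mul, ENNReal.toReal_mul,
    ENNReal.toReal_ofReal (by positivity)] at h4
  rw [h1, h2]
  exact h4

/-- The sum over the faces of an element of the trace-inverse inequalities; the simplices `κ_♭^F`
being disjoint, the constant does not depend on the number of faces. -/
theorem Regular.sum_faceIntegral_sq_le {C : ℝ} (hR : M.Regular C) (hC : 0 < C) (hd : 1 ≤ d)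
    {p : ℕ} (hp : 1 ≤ p) {g : E d → ℝ} (hg : IsPolyFun p g) {K : Fin M.nE ⊕ Fin M.nA}
    {s : Finset (Fin M.nF)} (hs : ∀ F ∈ s, M.IsFaceOf F K) :
    ∑ F ∈ s, M.faceIntegral F (fun x => g x ^ 2) ≤
      C * d * (d + 2) ^ 2 * ((p : ℝ) ^ 2 / M.diam K) * ∫ x in M.cell K, g x ^ 2 := by
  obtain ⟨a, hsub, hdisj, hle⟩ := hR K
  have hh := M.diam_pos hd K
  have hc : Continuous fun x => g x ^ 2 := hg.continuous.pow 2
  have hd' : (1 : ℝ) ≤ d := by exact_mod_cast hd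
  have hp' : (1 : ℝ) ≤ p := by exact_mod_cast hp
  -- Here `p ≥ 1` gives `2p + d ≤ (d + 2) p`; this is where `(d + 2)²` in the constant comes from.
  have hN : ((2 * p + d : ℕ) : ℝ) ^ 2 ≤ (d + 2) ^ 2 * (p : ℝ) ^ 2 := by
    rw [← mul_pow]
    push_cast
    gcongr
    nlinarith
  have hone : ∀ F ∈ s, M.faceIntegral F (fun x => g x ^ 2) ≤
      C * d * (d + 2) ^ 2 * ((p : ℝ) ^ 2 / M.diam K) *
        ∫ x in interior (M.cone F (a F)), g x ^ 2 := by
    intro F hF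
    have h1 := faceIntegral_sq_mul_le hR hd hg F (a F)
    have h2 := hle F (hs F hF)
    have hS := hR.face_measure_pos hd (hs F hF)
    -- Only the interiors are disjoint, and only they are known to lie in the open cell. Passing to
    -- them is harmless because the frontier of a convex set is null.
    have hae : interior (M.cone F (a F)) =ᵐ[volume] M.cone F (a F) :=
      interior_ae_eq_of_null_frontier ((convex_convexHull ℝ _).addHaar_frontier volume)
    rw [setIntegral_congr_set hae]
    set A := M.faceIntegral F (fun x => g x ^ 2)
    set V := (volume : Measure (E d)).real (M.cone F (a F))
    set S := (μHE[d - 1] : Measure (E d)).real (M.face F).closedInterior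
    set B := ∫ x in M.cone F (a F), g x ^ 2
    have hA : 0 ≤ A := integral_nonneg fun x => sq_nonneg _
    have hB : 0 ≤ B := integral_nonneg fun x => sq_nonneg _
    have h3 : M.diam K * S ≤ C * d * V := by
      rw [← mul_div_assoc, le_div_iff₀ hS] at h2
      linarith
    have h4 : A * M.diam K * S ≤ C * d * ((d + 2) ^ 2 * (p : ℝ) ^ 2) * B * S := by
      calc A * M.diam K * S = A * (M.diam K * S) := by ring
        _ ≤ A * (C * d * V) := by gcongr
        _ = C * d * (A * V) := by ring
        _ ≤ C * d * (((2 * p + d : ℕ) : ℝ) ^ 2 * S * B) := by gcongr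
        _ ≤ C * d * ((d + 2) ^ 2 * (p : ℝ) ^ 2 * S * B) := by gcongr
        _ = _ := by ring
    have h5 := le_of_mul_le_mul_right h4 hS
    rw [← le_div_iff₀ hh] at h5
    refine h5.trans (le_of_eq ?_)
    ring
  refine (Finset.sum_le_sum hone).trans ?_
  rw [← Finset.mul_sum]
  refine mul_le_mul_of_nonneg_left ?_ (by positivity)
  have hcell : ∀ F ∈ s, interior (M.cone F (a F)) ⊆ M.cell K := fun F hF =>
    (interior_mono (hsub F (hs F hF))).trans (M.interior_closure_cell K).subset
  have hint := M.integrableOn_cell hc K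
  rw [← integral_biUnion_finset s (fun F _ => isOpen_interior.measurableSet)
    (fun F hF G hG hne => hdisj F G (hs F hF) (hs G hG) hne)
    (fun F hF => hint.mono_set (hcell F hF))]
  exact setIntegral_mono_set hint (ae_of_all _ fun x => sq_nonneg _)
    (iUnion₂_subset hcell).eventuallyLE

/-- On the interface the outer normals of the two adjacent elements are opposite. -/
theorem normal_eq_neg (hd : 2 ≤ d) {F : Fin M.nF} {K L : Fin M.nE ⊕ Fin M.nA} (hKL : K ≠ L)
    (hK : M.IsFaceOf F K) (hL : M.IsFaceOf F L) : M.normal K F = -M.normal L F := by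
  have h1 := M.normal_spec K F hK
  have h2 := M.normal_spec L F hL
  set n := M.normal K F
  set n' := M.normal L F
  set V : Submodule ℝ (E d) := vectorSpan ℝ (range (M.face F).points)
  have hVr : Module.finrank ℝ V = d - 1 :=
    (M.face F).independent.finrank_vectorSpan (by simp)
  have horth : ∀ w : E d, (∀ i j, inner ℝ w ((M.face F).points i - (M.face F).points j) = 0) →
      w ∈ Vᗮ := by
    intro w hw
    rw [Submodule.mem_orthogonal']
    intro u hu
    refine Submodule.span_induction (p := fun u _ => inner ℝ w u = 0) ?_ (by simp) ?_ ?_ hu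
    · rintro _ ⟨_, ⟨i, rfl⟩, _, ⟨j, rfl⟩, rfl⟩
      exact hw i j
    · intro x y _ _ hx hy
      rw [inner_add_right, hx, hy, add_zero]
    · intro c x _ hx
      rw [inner_smul_right, hx, mul_zero]
  -- A face spans a hyperplane direction, so its unit normals are determined up to sign.
  have hfr : Module.finrank ℝ Vᗮ = 1 := by
    have := V.finrank_add_finrank_orthogonal
    rw [hVr, finrank_euclideanSpace_fin] at this
    omega
  have hn0 : n ≠ 0 := by
    intro h; have := h1.norm_eq; rw [h] at this; simp at this
  obtain ⟨c, hc⟩ : ∃ c : ℝ, n' = c • n := by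
    have := (finrank_eq_one_iff_of_nonzero' (⟨n, horth n h1.orthogonal⟩ : Vᗮ)
      (by simpa using hn0)).1 hfr ⟨n', horth n' h2.orthogonal⟩
    obtain ⟨c, hc⟩ := this
    exact ⟨c, (congrArg Subtype.val hc).symm⟩
  have hcabs : |c| = 1 := by
    have := h2.norm_eq
    rw [hc, norm_smul, h1.norm_eq, mul_one] at this
    exact this
  rcases (abs_eq zero_le_one).1 hcabs with rfl | rfl
  -- With equal normals, a point slightly behind the face would belong to both of the disjoint
  -- cells. The barycentre serves as relative interior point; its weights `1/d` are less than one
  -- because `d ≥ 2`.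
  · exfalso
    rw [one_smul] at hc
    obtain ⟨x, hx⟩ : (M.face F).interior.Nonempty := by
      have hn : (1 : ℝ) < ((d - 1 + 1 : ℕ) : ℝ) := by exact_mod_cast (by omega : 1 < d - 1 + 1)
      refine ⟨_, (Affine.Simplex.affineCombination_mem_interior_iff
        (w := fun _ => ((d - 1 + 1 : ℕ) : ℝ)⁻¹) ?_).2
        fun i => ⟨by positivity, inv_lt_one_of_one_lt₀ hn⟩⟩
      rw [Finset.sum_const, Finset.card_univ, Fintype.card_fin, nsmul_eq_mul,
        mul_inv_cancel₀ (by positivity)]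
    obtain ⟨t, ht1, ht2⟩ := ((h1.outer x hx).and (h2.outer x hx)).exists
    rw [hc] at ht2
    exact (M.disjoint_cell K L hKL).ne_of_mem ht1.1 ht2.1 rfl
  · rw [hc]; simp

end PolytopicMesh


/-! ### Algebraic inequalities for the consistency terms -/

theorem dotProduct_average_self_le {ι κ : Type*} [Fintype ι] (s : Finset κ) (a : κ → ι → ℝ) :
    ((s.card : ℝ)⁻¹ • ∑ K ∈ s, a K) ⬝ᵥ ((s.card : ℝ)⁻¹ • ∑ K ∈ s, a K) ≤
      ∑ K ∈ s, a K ⬝ᵥ a K := by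
  simp only [dotProduct]
  rw [Finset.sum_comm]
  refine Finset.sum_le_sum fun i _ => ?_
  simp only [Pi.smul_apply, Finset.sum_apply, smul_eq_mul]
  rcases s.eq_empty_or_nonempty with rfl | hs
  · simp
  have hc : (1 : ℝ) ≤ s.card := by exact_mod_cast hs.card_pos
  have h := sq_sum_le_card_mul_sum_sq (s := s) (f := fun K => a K i)
  have h2 : ∑ K ∈ s, a K i * a K i = ∑ K ∈ s, a K i ^ 2 :=
    Finset.sum_congr rfl fun K _ => by ring
  have h3 : 0 ≤ ∑ K ∈ s, a K i ^ 2 := Finset.sum_nonneg fun K _ => sq_nonneg _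
  rw [h2]
  have h4 : (∑ K ∈ s, a K i) ^ 2 ≤ (s.card : ℝ) ^ 2 * ∑ K ∈ s, a K i ^ 2 := by
    refine h.trans (mul_le_mul_of_nonneg_right ?_ h3)
    nlinarith
  calc _ = (∑ K ∈ s, a K i) ^ 2 / (s.card : ℝ) ^ 2 := by field_simp
    _ ≤ _ := by rw [div_le_iff₀ (by positivity)]; linarith

/-- Young's inequality, weighted so that the jump `b` consumes exactly half of the penalty `η |b|²`.
-/
theorem two_mul_abs_dotProduct_le {ι : Type*} [Fintype ι] (a b : ι → ℝ) {η : ℝ} (hη : 0 < η) :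
    2 * |a ⬝ᵥ b| ≤ η / 2 * (b ⬝ᵥ b) + 2 / η * (a ⬝ᵥ a) := by
  have h : |a ⬝ᵥ b| ≤ ∑ i, |a i * b i| := Finset.abs_sum_le_sum_abs _ _
  refine (mul_le_mul_of_nonneg_left h zero_le_two).trans ?_
  simp only [dotProduct, Finset.mul_sum, ← Finset.sum_add_distrib]
  refine Finset.sum_le_sum fun i _ => ?_
  rw [abs_mul]
  have h1 : 0 ≤ (η * |b i| - 2 * |a i|) ^ 2 / (2 * η) := by positivity
  have h2 : (η * |b i| - 2 * |a i|) ^ 2 / (2 * η) =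
      η / 2 * (b i * b i) + 2 / η * (a i * a i) - 2 * (|a i| * |b i|) := by
    rw [← abs_mul_abs_self (b i), ← abs_mul_abs_self (a i)]
    field_simp
    ring
  linarith

/-- Absorption of the consistency terms, given the trace-inverse inequalities. -/
theorem two_mul_abs_sum_le {ι κ : Type*} [Fintype κ] [DecidableEq κ] (s : Finset ι)
    (adj : ι → Finset κ) (X J η : ι → ℝ) (T : ι → κ → ℝ) (w B : κ → ℝ) {C α : ℝ} (hC : 0 < C)
    (hα : 4 * C ≤ α) (hw : ∀ K, 0 < w K) (hη : ∀ F ∈ s, ∀ K ∈ adj F, α * w K ≤ η F)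
    (hT : ∀ F ∈ s, ∀ K, 0 ≤ T F K) (hB : ∀ K, 0 ≤ B K)
    (hX : ∀ F ∈ s, 2 * |X F| ≤ η F / 2 * J F + 2 / η F * ∑ K ∈ adj F, T F K)
    (hsum : ∀ K, ∑ F ∈ s with K ∈ adj F, T F K ≤ C * w K * B K) :
    2 * |∑ F ∈ s, X F| ≤ 1 / 2 * (∑ K, B K + ∑ F ∈ s, η F * J F) := by
  have hα0 : 0 < α := by linarith
  have h1 : 2 * |∑ F ∈ s, X F| ≤
      ∑ F ∈ s, (η F / 2 * J F + 2 / η F * ∑ K ∈ adj F, T F K) := by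
    calc 2 * |∑ F ∈ s, X F| ≤ 2 * ∑ F ∈ s, |X F| := by
          gcongr; exact Finset.abs_sum_le_sum_abs _ _
      _ = ∑ F ∈ s, 2 * |X F| := Finset.mul_sum _ _ _
      _ ≤ _ := Finset.sum_le_sum hX
  have h2 : ∑ F ∈ s, 2 / η F * ∑ K ∈ adj F, T F K ≤ ∑ K, 1 / 2 * B K := by
    calc ∑ F ∈ s, 2 / η F * ∑ K ∈ adj F, T F K
        ≤ ∑ F ∈ s, ∑ K ∈ adj F, 2 / (α * w K) * T F K := by
          refine Finset.sum_le_sum fun F hF => ?_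
          rw [Finset.mul_sum]
          refine Finset.sum_le_sum fun K hK => ?_
          have := mul_pos hα0 (hw K)
          exact mul_le_mul_of_nonneg_right
            (div_le_div_of_nonneg_left zero_le_two this (hη F hF K hK)) (hT F hF K)
      -- Regrouping by elements lets the trace-inverse inequality, already summed over the faces of
      -- `K`, apply as a whole.
      _ = ∑ K, ∑ F ∈ s with K ∈ adj F, 2 / (α * w K) * T F K :=
          Finset.sum_comm' (by simp)
      _ ≤ ∑ K, 1 / 2 * B K := by
          refine Finset.sum_le_sum fun K _ => ?_
          have hwK := hw K
          rw [← Finset.mul_sum]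
          calc 2 / (α * w K) * ∑ F ∈ s with K ∈ adj F, T F K
              ≤ 2 / (α * w K) * (C * w K * B K) := by gcongr; exact hsum K
            _ = 2 * C / α * B K := by field_simp
            -- This is the step that requires `α ≥ 4C`.
            _ ≤ 1 / 2 * B K := by
              refine mul_le_mul_of_nonneg_right ?_ (hB K)
              rw [div_le_div_iff₀ hα0 two_pos]
              linarith
  rw [Finset.sum_add_distrib] at h1
  have h3 : ∑ F ∈ s, η F / 2 * J F = 1 / 2 * ∑ F ∈ s, η F * J F := by
    rw [Finset.mul_sum]
    exact Finset.sum_congr rfl fun F _ => by ring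
  rw [← Finset.mul_sum] at h2
  linarith

theorem dotProduct_self_nonneg_real {ι : Type*} [Fintype ι] (a : ι → ℝ) : 0 ≤ a ⬝ᵥ a :=
  Finset.sum_nonneg fun _ _ => mul_self_nonneg _

/-! ### Bound of the consistency terms -/

namespace PolytopicMesh

variable {d : ℕ} {D : Domain d} {M : PolytopicMesh D}

theorem Regular.two_mul_abs_faceIntegral_le {C : ℝ} (hR : M.Regular C) (hd : 1 ≤ d)
    {ι κ : Type*} [Fintype ι] (s : Finset κ) (a : κ → E d → ι → ℝ) (ha : ∀ K, Continuous (a K))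
    (b : E d → ι → ℝ) (hb : Continuous b) {η : ℝ} (hη : 0 < η) (F : Fin M.nF) :
    2 * |M.faceIntegral F fun x => ((s.card : ℝ)⁻¹ • ∑ K ∈ s, a K x) ⬝ᵥ b x| ≤
      η / 2 * M.faceIntegral F (fun x => b x ⬝ᵥ b x) +
        2 / η * ∑ K ∈ s, M.faceIntegral F fun x => a K x ⬝ᵥ a K x := by
  have hi : ∀ {f g : E d → ι → ℝ}, Continuous f → Continuous g →
      IntegrableOn (fun x => f x ⬝ᵥ g x) (M.face F).closedInterior μHE[d - 1] :=
    fun hf hg => hR.integrableOn_face hd F (hf.dotProduct hg)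
  have hav : Continuous fun x => ((s.card : ℝ)⁻¹ • ∑ K ∈ s, a K x) := by
    fun_prop
  simp only [faceIntegral]
  rw [← integral_finsetSum s fun K _ => hi (ha K) (ha K), ← integral_const_mul,
    ← integral_const_mul, ← integral_add ((hi hb hb).const_mul _)
      ((integrable_finsetSum s fun K _ => hi (ha K) (ha K)).const_mul _)]
  refine (mul_le_mul_of_nonneg_left (abs_integral_le_integral_abs) zero_le_two).trans ?_
  rw [← integral_const_mul]
  refine integral_mono ((hi hav hb).abs.const_mul _) (((hi hb hb).const_mul _).add
      ((integrable_finsetSum s fun K _ => hi (ha K) (ha K)).const_mul _)) fun x => ?_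
  refine (two_mul_abs_dotProduct_le _ _ hη).trans ?_
  have := dotProduct_average_self_le s fun K => a K x
  gcongr

/-- The consistency terms are bounded by half of the square of the `dG` norm. -/
theorem Regular.consistency_le {C : ℝ} (hR : M.Regular C) (hC : 0 < C) (hd : 1 ≤ d)
    {ι κ : Type*} [Fintype ι] [Fintype κ] [DecidableEq κ] (e : κ → Fin M.nE ⊕ Fin M.nA)
    (adj : Fin M.nF → Finset κ) (hadj : ∀ F, ∀ K ∈ adj F, M.IsFaceOf F (e K))
    (s : Finset (Fin M.nF)) (p : κ → ℕ) (hp : ∀ K, 1 ≤ p K)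
    (a S : κ → E d → ι → ℝ) (ha : ∀ K, Continuous (a K))
    (hS : ∀ K i, IsPolyFun (p K) fun x => S K x i)
    (b : Fin M.nF → E d → ι → ℝ) (hb : ∀ F, Continuous (b F))
    (cb : κ → ℝ) (hcb : ∀ K, 0 < cb K)
    (haS : ∀ K x, a K x ⬝ᵥ a K x ≤ cb K * (S K x ⬝ᵥ S K x)) (η : Fin M.nF → ℝ) {α : ℝ}
    (hα : 4 * (C * d * (d + 2) ^ 2) ≤ α) (hηpos : ∀ F ∈ s, 0 < η F)
    (hη : ∀ F ∈ s, ∀ K ∈ adj F, α * (cb K * (p K : ℝ) ^ 2 / M.diam (e K)) ≤ η F) :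
    2 * |∑ F ∈ s, M.faceIntegral F fun x =>
        (((adj F).card : ℝ)⁻¹ • ∑ K ∈ adj F, a K x) ⬝ᵥ b F x| ≤
      1 / 2 * ((∑ K, ∫ x in M.cell (e K), S K x ⬝ᵥ S K x) +
        ∑ F ∈ s, η F * M.faceIntegral F fun x => b F x ⬝ᵥ b F x) := by
  have hd' : (1 : ℝ) ≤ d := by exact_mod_cast hd
  refine two_mul_abs_sum_le s adj _ _ η (fun F K => M.faceIntegral F fun x => a K x ⬝ᵥ a K x)
    (fun K => cb K * (p K : ℝ) ^ 2 / M.diam (e K)) _ (C := C * d * (d + 2) ^ 2) (by positivity)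
    hα (fun K => ?_) hη (fun F _ K => integral_nonneg fun x => dotProduct_self_nonneg_real (a K x))
    (fun K => integral_nonneg fun x => dotProduct_self_nonneg_real (S K x))
    (fun F hF => hR.two_mul_abs_faceIntegral_le hd _ a ha _ (hb F) (hηpos F hF) F) fun K => ?_
  · have := hcb K
    have := M.diam_pos hd (e K)
    have : (0 : ℝ) < p K := by exact_mod_cast hp K
    positivity
  · have hSq : ∀ i, Continuous fun x => S K x i ^ 2 := fun i => (hS K i).continuous.pow 2
    -- The flux `a` is first replaced by `S`, at the cost of `cb`. The inverse inequality is then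
    -- applied to the polynomial components of `S`, whose volume norm is the one in the dG norm.
    have hface : ∀ F, M.faceIntegral F (fun x => a K x ⬝ᵥ a K x) ≤
        cb K * ∑ i, M.faceIntegral F fun x => S K x i ^ 2 := by
      intro F
      simp only [faceIntegral]
      rw [← integral_finsetSum _ fun i _ =>
        hR.integrableOn_face hd F (hSq i), ← integral_const_mul]
      refine integral_mono (hR.integrableOn_face hd F ((ha K).dotProduct (ha K)))
        ((integrable_finsetSum _ fun i _ =>
          hR.integrableOn_face hd F (hSq i)).const_mul _) fun x => ?_
      refine (haS K x).trans (le_of_eq ?_)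
      simp only [dotProduct, sq]
    have hcell : ∫ x in M.cell (e K), S K x ⬝ᵥ S K x =
        ∑ i, ∫ x in M.cell (e K), S K x i ^ 2 := by
      rw [← integral_finsetSum _ fun i _ => M.integrableOn_cell (hSq i) (e K)]
      simp only [dotProduct, sq]
    calc ∑ F ∈ s with K ∈ adj F, M.faceIntegral F (fun x => a K x ⬝ᵥ a K x)
        ≤ ∑ F ∈ s with K ∈ adj F, cb K * ∑ i, M.faceIntegral F (fun x => S K x i ^ 2) :=
          Finset.sum_le_sum fun F _ => hface F
      _ = cb K * ∑ i, ∑ F ∈ s with K ∈ adj F, M.faceIntegral F (fun x => S K x i ^ 2) := by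
          rw [← Finset.mul_sum, Finset.sum_comm]
      _ ≤ cb K * ∑ i, C * d * (d + 2) ^ 2 * ((p K : ℝ) ^ 2 / M.diam (e K)) *
            ∫ x in M.cell (e K), S K x i ^ 2 := by
          refine mul_le_mul_of_nonneg_left (Finset.sum_le_sum fun i _ => ?_) (hcb K).le
          exact hR.sum_faceIntegral_sq_le hC hd (hp K) (hS K i)
            fun F hF => hadj F K (Finset.mem_filter.1 hF).2
      _ = _ := by
          rw [← Finset.mul_sum, hcell]
          ring

end PolytopicMesh

/-! ### The elasticity tensor -/

namespace Material

variable {d : ℕ} {D : Domain d} {M : PolytopicMesh D} (mat : Material M)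

theorem C_transpose (K : Fin M.nE) : (mat.C K)ᵀ = mat.C K := by
  ext ⟨i, j⟩ ⟨k, l⟩
  exact mat.C_major K k l i j

theorem C_mulVec_swap (K : Fin M.nE) (τ : Fin d × Fin d → ℝ) :
    mat.C K *ᵥ (fun q => τ q.swap) = mat.C K *ᵥ τ := by
  ext ⟨i, j⟩
  simp only [Matrix.mulVec, dotProduct]
  refine Fintype.sum_equiv (Equiv.prodComm _ _) _ _ ?_
  rintro ⟨k, l⟩
  simp only [Equiv.prodComm_apply, Prod.swap_prod_mk]
  rw [mat.C_major K i j k l, mat.C_minor, mat.C_major]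

/-- Ellipticity is assumed on symmetric tensors only. By the major and minor symmetries the
quadratic form sees only the symmetric part of `τ`, so it is nonnegative on all matrices, and
`sqrtC` is a genuine square root. -/
theorem C_posSemidef (K : Fin M.nE) : (mat.C K).PosSemidef := by
  refine Matrix.PosSemidef.of_dotProduct_mulVec_nonneg (mat.C_transpose K) fun τ => ?_
  obtain ⟨c₀, hc₀, h⟩ := mat.C_elliptic
  set σ : Fin d × Fin d → ℝ := fun q => (1 / 2 : ℝ) * (τ q + τ q.swap) with hσ
  have h1 : mat.C K *ᵥ σ = mat.C K *ᵥ τ := by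
    have : σ = (1 / 2 : ℝ) • (τ + fun q => τ q.swap) := rfl
    rw [this, Matrix.mulVec_smul, Matrix.mulVec_add, C_mulVec_swap]
    module
  have h2 : σ ⬝ᵥ (mat.C K *ᵥ σ) = τ ⬝ᵥ (mat.C K *ᵥ τ) := by
    have hs : ∀ x y, x ⬝ᵥ (mat.C K *ᵥ y) = y ⬝ᵥ (mat.C K *ᵥ x) := by
      intro x y
      rw [Matrix.dotProduct_mulVec, ← Matrix.mulVec_transpose, mat.C_transpose, dotProduct_comm]
    rw [h1, hs σ τ, h1]
  have h3 := h K σ fun i j => by simp [hσ, add_comm]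
  rw [h2] at h3
  refine le_trans (mul_nonneg hc₀.le (dotProduct_self_nonneg_real σ)) ?_
  simpa using h3

theorem sqrtC_mul_self (K : Fin M.nE) : mat.sqrtC K * mat.sqrtC K = mat.C K :=
  CFC.sqrt_mul_sqrt_self _ (Matrix.nonneg_iff_posSemidef.2 (mat.C_posSemidef K))

theorem sqrtC_transpose (K : Fin M.nE) : (mat.sqrtC K)ᵀ = mat.sqrtC K := by
  have h : (mat.sqrtC K).PosSemidef :=
    Matrix.nonneg_iff_posSemidef.1 (CFC.sqrt_nonneg (mat.C K))
  exact h.1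

theorem sqrtC_dotProduct (K : Fin M.nE) (x y : Fin d × Fin d → ℝ) :
    (mat.sqrtC K *ᵥ x) ⬝ᵥ (mat.sqrtC K *ᵥ y) = (mat.C K *ᵥ x) ⬝ᵥ y := by
  rw [Matrix.dotProduct_mulVec, ← Matrix.mulVec_transpose, sqrtC_transpose, Matrix.mulVec_mulVec,
    sqrtC_mul_self]

theorem C_dotProduct_comm (K : Fin M.nE) (x y : Fin d × Fin d → ℝ) :
    (mat.C K *ᵥ x) ⬝ᵥ y = (mat.C K *ᵥ y) ⬝ᵥ x := by
  rw [← sqrtC_dotProduct, dotProduct_comm, sqrtC_dotProduct]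

theorem dotProduct_self_eq_norm_sq {ι : Type*} [Fintype ι] (x : ι → ℝ) :
    x ⬝ᵥ x = ‖WithLp.toLp 2 x‖ ^ 2 := by
  rw [EuclideanSpace.norm_sq_eq]
  simp [dotProduct, sq]

/-- Writing `ℂ x = ℂ^{1/2}(ℂ^{1/2} x)` costs one operator norm of `ℂ^{1/2}`; this explains the
weight in `η`. -/
theorem C_mulVec_sq_le (K : Fin M.nE) (x : Fin d × Fin d → ℝ) :
    (mat.C K *ᵥ x) ⬝ᵥ (mat.C K *ᵥ x) ≤
      mat.Cbar K * ((mat.sqrtC K *ᵥ x) ⬝ᵥ (mat.sqrtC K *ᵥ x)) := by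
  have h : mat.C K *ᵥ x = mat.sqrtC K *ᵥ (mat.sqrtC K *ᵥ x) := by
    rw [Matrix.mulVec_mulVec, sqrtC_mul_self]
  rw [h, dotProduct_self_eq_norm_sq, dotProduct_self_eq_norm_sq, Cbar, ← mul_pow]
  have := (Matrix.toEuclideanCLM (𝕜 := ℝ) (mat.sqrtC K)).le_opNorm
    (WithLp.toLp 2 (mat.sqrtC K *ᵥ x))
  gcongr
  simpa using this

theorem Cbar_pos (hd : 1 ≤ d) (K : Fin M.nE) : 0 < mat.Cbar K := by
  refine pow_pos (norm_pos_iff.2 fun h => ?_) 2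
  have h0 : mat.sqrtC K = 0 := by simpa using h
  obtain ⟨c₀, hc₀, hell⟩ := mat.C_elliptic
  -- The all-ones tensor is symmetric and nonzero, so ellipticity excludes `ℂ = 0`.
  have h1 := hell K (fun _ => 1) fun _ _ => rfl
  rw [← sqrtC_mul_self, h0] at h1
  have hd' : (1 : ℝ) ≤ d := by exact_mod_cast hd
  simp [dotProduct] at h1
  nlinarith [mul_pos (mul_pos hc₀ (by linarith : (0 : ℝ) < d)) (by linarith : (0 : ℝ) < d)]

end Material


/-! ### Cells and subdomains, integrability with bounded weights -/

theorem interior_closure_of_convex {d : ℕ} {S : Set (E d)} (hS : IsOpen S) (hc : Convex ℝ S) :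
    interior (closure S) = S := by
  rcases S.eq_empty_or_nonempty with rfl | hne
  · simp
  · rw [hc.interior_closure_eq_interior_of_nonempty_interior (by rwa [hS.interior_eq]),
      hS.interior_eq]

theorem Domain.Ωe_subset {d : ℕ} (D : Domain d) : D.Ωe ⊆ D.Ω := by
  rw [← interior_closure_of_convex D.isOpen_Ω D.convex_Ω]
  refine interior_maximal (subset_closure.trans ?_) D.isOpen_Ωe
  rw [D.closure_eq]
  exact subset_union_left

namespace PolytopicMesh

variable {d : ℕ} {D : Domain d} (M : PolytopicMesh D)

theorem cell_subset_Ωe (K : Fin M.nE) : M.cell (Sum.inl K) ⊆ D.Ωe := by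
  rw [← interior_closure_of_convex D.isOpen_Ωe D.convex_Ωe]
  exact interior_maximal (subset_closure.trans (M.elastic_cell K)) (M.isOpen_cell _)

theorem cell_subset_Ωa (K : Fin M.nA) : M.cell (Sum.inr K) ⊆ D.Ωa := by
  rw [← interior_closure_of_convex D.isOpen_Ωa D.convex_Ωa]
  exact interior_maximal (subset_closure.trans (M.acoustic_cell K)) (M.isOpen_cell _)

end PolytopicMesh

/-- `w` is an essentially bounded measurable function on `S`. -/
def IsBoundedWeight {d : ℕ} (S : Set (E d)) (w : E d → ℝ) : Prop :=
  AEMeasurable w (volume.restrict S) ∧ ∃ B, ∀ᵐ x ∂volume.restrict S, |w x| ≤ B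

theorem IsBoundedWeight.mono {d : ℕ} {S S' : Set (E d)} {w : E d → ℝ} (h : IsBoundedWeight S w)
    (hS : S' ⊆ S) : IsBoundedWeight S' w :=
  ⟨h.1.mono_set hS, h.2.imp fun _ hB => ae_restrict_of_ae_restrict_of_subset hS hB⟩

theorem IsBoundedWeight.mul {d : ℕ} {S : Set (E d)} {w w' : E d → ℝ} (h : IsBoundedWeight S w)
    (h' : IsBoundedWeight S w') : IsBoundedWeight S fun x => w x * w' x := by
  obtain ⟨hm, B, hB⟩ := h
  obtain ⟨hm', B', hB'⟩ := h'
  refine ⟨hm.mul hm', B * B', ?_⟩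
  filter_upwards [hB, hB'] with x hx hx'
  rw [abs_mul]
  exact mul_le_mul hx hx' (abs_nonneg _) ((abs_nonneg _).trans hx)

theorem IsBoundedWeight.integrableOn {d : ℕ} {S : Set (E d)} {w g : E d → ℝ}
    (h : IsBoundedWeight S w) (hg : IntegrableOn g S) : IntegrableOn (fun x => w x * g x) S := by
  obtain ⟨hm, B, hB⟩ := h
  exact hg.bdd_mul hm.aestronglyMeasurable (by simpa using hB)

namespace Material

variable {d : ℕ} {D : Domain d} {M : PolytopicMesh D} (mat : Material M)

theorem isBoundedWeight_rhoE : IsBoundedWeight D.Ωe mat.rhoE := by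
  refine ⟨mat.rhoE_meas, mat.rhoEMax, ?_⟩
  filter_upwards [mat.rhoE_bounds] with x hx
  rw [abs_of_nonneg (mat.rhoEMin_pos.le.trans hx.1)]
  exact hx.2

theorem isBoundedWeight_zeta : IsBoundedWeight D.Ωe mat.zeta := by
  refine IsBoundedWeight.mono ⟨mat.zeta_meas, ?_⟩ D.Ωe_subset
  obtain ⟨B, hB⟩ := mat.zeta_bounds
  refine ⟨B, ?_⟩
  filter_upwards [hB] with x hx
  rw [abs_of_nonneg hx.1]
  exact hx.2

theorem rhoA_pos (K : Fin M.nA) : 0 < mat.rhoA K := mat.rhoAMin_pos.trans_le (mat.rhoA_bounds K).1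

end Material

/-! ### Linearity of the traces -/

section Linear

variable {d : ℕ} {D : Domain d} {M : PolytopicMesh D} {pe : Fin M.nE → ℕ} {pa : Fin M.nA → ℕ}

theorem Poly.val_add {p : ℕ} (q r : Poly d p) (x : E d) : (q + r).val x = q.val x + r.val x := by
  simp [Poly.val]

theorem Poly.val_smul {p : ℕ} (c : ℝ) (q : Poly d p) (x : E d) : (c • q).val x = c * q.val x := by
  simp [Poly.val, MvPolynomial.smul_eval]

theorem Poly.partialVal_add {p : ℕ} (i : Fin d) (q r : Poly d p) (x : E d) :
    (q + r).partialVal i x = q.partialVal i x + r.partialVal i x := by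
  simp [Poly.partialVal]

theorem Poly.partialVal_smul {p : ℕ} (i : Fin d) (c : ℝ) (q : Poly d p) (x : E d) :
    (c • q).partialVal i x = c * q.partialVal i x := by
  simp [Poly.partialVal, MvPolynomial.smul_eval]

theorem isLinearMap_vecVal {p : ℕ} (x : E d) :
    IsLinearMap ℝ fun v : Fin d → Poly d p => vecVal v x :=
  ⟨fun u v => by ext i; simp [vecVal, Poly.val_add], fun c v => by
    ext i; simp [vecVal, Poly.val_smul]⟩

theorem isLinearMap_strain {p : ℕ} (x : E d) :
    IsLinearMap ℝ fun v : Fin d → Poly d p => strain v x :=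
  ⟨fun u v => by ext i; simp only [strain, Pi.add_apply, Poly.partialVal_add]; ring,
    fun c v => by
      ext i; simp only [strain, Pi.smul_apply, Poly.partialVal_smul, smul_eq_mul]; ring⟩

theorem isLinearMap_grad {p : ℕ} (x : E d) : IsLinearMap ℝ fun q : Poly d p => grad q x :=
  ⟨fun u v => by ext i; simp [grad, Poly.partialVal_add],
    fun c v => by ext i; simp [grad, Poly.partialVal_smul]⟩

theorem isLinearMap_jumpE (F : Fin M.nF) (x : E d) :
    IsLinearMap ℝ fun v : VE M pe => jumpE v F x :=
  ⟨fun u v => by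
    ext i; simp only [jumpE, Pi.add_apply, Poly.val_add, add_mul, Finset.sum_add_distrib],
  fun c v => by
    ext i; simp only [jumpE, Pi.smul_apply, Poly.val_smul, smul_eq_mul, mul_assoc, Finset.mul_sum]⟩

theorem isLinearMap_jumpA (F : Fin M.nF) (x : E d) :
    IsLinearMap ℝ fun v : VA M pa => jumpA v F x :=
  ⟨fun u v => by
    simp only [jumpA, Pi.add_apply, Poly.val_add, add_smul, Finset.sum_add_distrib],
  fun c v => by
    simp only [jumpA, Pi.smul_apply, Poly.val_smul, mul_smul, Finset.smul_sum]⟩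

theorem isLinearMap_stress (mat : Material M) (K : Fin M.nE) {p : ℕ} (x : E d) :
    IsLinearMap ℝ fun v : Fin d → Poly d p => mat.stress K v x :=
  ⟨fun u v => by
    simp only [Material.stress, (isLinearMap_strain x).map_add, Matrix.mulVec_add],
  fun c v => by
    simp only [Material.stress, (isLinearMap_strain x).map_smul, Matrix.mulVec_smul]⟩

theorem isLinearMap_avgStress (mat : Material M) (F : Fin M.nF) (x : E d) :
    IsLinearMap ℝ fun v : VE M pe => avgStress mat v F x :=
  ⟨fun u v => by
    simp only [avgStress, Pi.add_apply, (isLinearMap_stress mat _ x).map_add,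
      Finset.sum_add_distrib, smul_add],
  fun c v => by
    simp only [avgStress, Pi.smul_apply, (isLinearMap_stress mat _ x).map_smul,
      ← Finset.smul_sum]
    rw [smul_comm]⟩

theorem isLinearMap_avgFlux (mat : Material M) (F : Fin M.nF) (x : E d) :
    IsLinearMap ℝ fun v : VA M pa => avgFlux mat v F x :=
  ⟨fun u v => by
    simp only [avgFlux, Pi.add_apply, (isLinearMap_grad x).map_add,
      Finset.sum_add_distrib, smul_add],
  fun c v => by
    simp only [avgFlux, Pi.smul_apply, (isLinearMap_grad x).map_smul]
    simp only [Finset.smul_sum, smul_comm c]⟩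

/-! ### Continuity of the traces -/

theorem Poly.continuous_val {p : ℕ} (q : Poly d p) : Continuous q.val := q.isPolyFun_val.continuous

theorem Poly.continuous_partialVal {p : ℕ} (i : Fin d) (q : Poly d p) :
    Continuous (q.partialVal i) := (q.isPolyFun_partialVal i).continuous

theorem continuous_vecVal {p : ℕ} (v : Fin d → Poly d p) : Continuous (vecVal v) :=
  (PiLp.continuous_toLp 2 _).comp (continuous_pi fun i => (v i).continuous_val)

theorem continuous_grad {p : ℕ} (q : Poly d p) : Continuous (grad q) :=
  (PiLp.continuous_toLp 2 _).comp (continuous_pi fun i => q.continuous_partialVal i)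

theorem continuous_strain {p : ℕ} (v : Fin d → Poly d p) : Continuous (strain v) :=
  continuous_pi fun ij => (((v ij.1).continuous_partialVal ij.2).add
    ((v ij.2).continuous_partialVal ij.1)).div_const 2

theorem continuous_stress (mat : Material M) (K : Fin M.nE) {p : ℕ} (v : Fin d → Poly d p) :
    Continuous (mat.stress K v) := continuous_const.matrix_mulVec (continuous_strain v)

theorem continuous_jumpE (v : VE M pe) (F : Fin M.nF) : Continuous (jumpE v F) :=
  continuous_pi fun _ => continuous_finsetSum _ fun _ _ =>
    (Poly.continuous_val _).mul continuous_const

theorem continuous_jumpA (v : VA M pa) (F : Fin M.nF) : Continuous (jumpA v F) :=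
  continuous_finsetSum _ fun _ _ => (Poly.continuous_val _).smul continuous_const

theorem continuous_avgStress (mat : Material M) (v : VE M pe) (F : Fin M.nF) :
    Continuous (avgStress mat v F) := by
  have := fun K => continuous_stress mat K (v K)
  unfold avgStress
  fun_prop

theorem continuous_avgFlux (mat : Material M) (v : VA M pa) (F : Fin M.nF) :
    Continuous (avgFlux mat v F) := by
  have := fun K => continuous_grad (v K)
  unfold avgFlux
  fun_prop

end Linear

/-! ### Bilinear forms -/

/-- `f` is a bilinear form. -/
def IsBilin {V : Type*} [AddCommGroup V] [Module ℝ V] (f : V → V → ℝ) : Prop :=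
  ∃ B : V →ₗ[ℝ] V →ₗ[ℝ] ℝ, ∀ u v, f u v = B u v

namespace IsBilin

variable {V : Type*} [AddCommGroup V] [Module ℝ V]

theorem of_isLinearMap {W : Type*} [AddCommGroup W] [Module ℝ W] {P Q : V → W}
    (hP : IsLinearMap ℝ P) (hQ : IsLinearMap ℝ Q) (B : W →ₗ[ℝ] W →ₗ[ℝ] ℝ) :
    IsBilin fun u v => B (P u) (Q v) :=
  ⟨B.compl₁₂ hP.mk' hQ.mk', fun _ _ => rfl⟩

theorem dotProduct {ι : Type*} [Fintype ι] {P Q : V → ι → ℝ} (hP : IsLinearMap ℝ P)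
    (hQ : IsLinearMap ℝ Q) : IsBilin fun u v => P u ⬝ᵥ Q v :=
  of_isLinearMap hP hQ (dotProductBilin ℝ ℝ)

theorem inner {d : ℕ} {P Q : V → E d} (hP : IsLinearMap ℝ P) (hQ : IsLinearMap ℝ Q) :
    IsBilin fun u v => inner ℝ (P u) (Q v) :=
  of_isLinearMap hP hQ (innerₗ (E d))

theorem add {f g : V → V → ℝ} (hf : IsBilin f) (hg : IsBilin g) :
    IsBilin fun u v => f u v + g u v := by
  obtain ⟨B, hB⟩ := hf
  obtain ⟨B', hB'⟩ := hg
  exact ⟨B + B', fun u v => by simp [hB, hB']⟩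

theorem const_mul {f : V → V → ℝ} (hf : IsBilin f) (c : ℝ) : IsBilin fun u v => c * f u v := by
  obtain ⟨B, hB⟩ := hf
  exact ⟨c • B, fun u v => by simp [hB]⟩

theorem sub {f g : V → V → ℝ} (hf : IsBilin f) (hg : IsBilin g) :
    IsBilin fun u v => f u v - g u v := by
  obtain ⟨B, hB⟩ := hf
  obtain ⟨B', hB'⟩ := hg
  exact ⟨B - B', fun u v => by simp [hB, hB']⟩

theorem sum {ι : Type*} (s : Finset ι) {f : ι → V → V → ℝ} (hf : ∀ i, IsBilin (f i)) :
    IsBilin fun u v => ∑ i ∈ s, f i u v := by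
  choose B hB using hf
  exact ⟨∑ i ∈ s, B i, fun u v => by simp [hB]⟩

theorem integral {X : Type*} [MeasurableSpace X] {μ : Measure X} {f : X → V → V → ℝ}
    (hf : ∀ x, IsBilin (f x)) (hi : ∀ u v, Integrable (fun x => f x u v) μ) :
    IsBilin fun u v => ∫ x, f x u v ∂μ := by
  choose B hB using hf
  refine ⟨LinearMap.mk₂ ℝ (fun u v => ∫ x, f x u v ∂μ) (fun u u' v => ?_) (fun c u v => ?_)
    (fun u v v' => ?_) (fun c u v => ?_), fun u v => rfl⟩
  · rw [← integral_add (hi u v) (hi u' v)]; simp [hB]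
  · rw [smul_eq_mul, ← integral_const_mul]; simp [hB]
  · rw [← integral_add (hi u v) (hi u v')]; simp [hB]
  · rw [smul_eq_mul, ← integral_const_mul]; simp [hB]

/-- The derivative of a symmetric quadratic form along a differentiable path. -/
theorem hasDerivWithinAt_self [Module.Finite ℝ V] {f : V → V → ℝ} (hf : IsBilin f)
    (hsymm : ∀ u v, f u v = f v u) {S : Set ℝ} {t : ℝ} {u : ℝ → V} {u' : V}
    (hu : ∀ ℓ : V →ₗ[ℝ] ℝ, HasDerivWithinAt (fun s => ℓ (u s)) (ℓ u') S t) :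
    HasDerivWithinAt (fun s => f (u s) (u s)) (2 * f (u t) u') S t := by
  obtain ⟨B, hB⟩ := hf
  let b := Module.finBasis ℝ V
  -- Differentiability of the path is known only through linear functionals; in a basis the form is
  -- a finite sum of products of two functionals.
  have hexp : ∀ x y, f x y = ∑ i, b.coord i x * B (b i) y := by
    intro x y
    rw [hB]
    calc B x y = B (∑ i, b.repr x i • b i) y := by rw [b.sum_repr]
      _ = ∑ i, b.coord i x * B (b i) y := by
        simp only [map_sum, LinearMap.sum_apply, map_smul, LinearMap.smul_apply, smul_eq_mul,
          Module.Basis.coord_apply]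
  have h : HasDerivWithinAt (fun s => ∑ i, b.coord i (u s) * B (b i) (u s))
      (∑ i, (b.coord i u' * B (b i) (u t) + b.coord i (u t) * B (b i) u')) S t :=
    HasDerivWithinAt.fun_sum fun i _ => (hu (b.coord i)).mul (hu (B (b i)))
  rw [Finset.sum_add_distrib, ← hexp, ← hexp, hsymm u' (u t), ← two_mul] at h
  simpa only [← hexp] using h

end IsBilin

/-! ### Bilinearity and symmetry of the discrete forms, cancellation on the interface -/

section Forms

variable {d : ℕ} {D : Domain d} {M : PolytopicMesh D} {pe : Fin M.nE → ℕ} {pa : Fin M.nA → ℕ}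

theorem inner_eq_dotProduct (x y : E d) : inner ℝ x y = x.ofLp ⬝ᵥ y.ofLp := by
  simp [PiLp.inner_apply, dotProduct, mul_comm]

theorem integrableOn_prodE {w : E d → ℝ} (hw : IsBoundedWeight D.Ωe w) (K : Fin M.nE)
    {p : ℕ} (u v : Fin d → Poly d p) :
    IntegrableOn (fun x => inner ℝ (w x • vecVal u x) (vecVal v x)) (M.cell (Sum.inl K)) := by
  have h := (hw.mono (M.cell_subset_Ωe K)).integrableOn
    (M.integrableOn_cell ((continuous_vecVal u).inner (continuous_vecVal v)) (Sum.inl K))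
  simpa only [real_inner_smul_left] using h

theorem isBilin_prodE {w : E d → ℝ} (hw : IsBoundedWeight D.Ωe w) :
    IsBilin (prodE w : VE M pe → VE M pe → ℝ) := by
  refine IsBilin.sum _ fun K => IsBilin.integral (fun x => ?_)
    fun u v => integrableOn_prodE hw K (u K) (v K)
  have hl : IsLinearMap ℝ fun v : VE M pe => vecVal (v K) x :=
    ⟨fun _ _ => (isLinearMap_vecVal x).map_add _ _, fun _ _ => (isLinearMap_vecVal x).map_smul _ _⟩
  have := (IsBilin.inner hl hl).const_mul (w x)
  simpa only [real_inner_smul_left] using this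

theorem prodE_comm (w : E d → ℝ) (u v : VE M pe) : prodE w u v = prodE w v u := by
  simp only [prodE, real_inner_smul_left]
  simp only [real_inner_comm]

theorem integrableOn_prodA (w : ℝ) (K : Fin M.nA) {p : ℕ} (u v : Poly d p) :
    IntegrableOn (fun x => (w * u.val x) * v.val x) (M.cell (Sum.inr K)) :=
  M.integrableOn_cell ((u.continuous_val.const_mul w).mul v.continuous_val) (Sum.inr K)

theorem isBilin_prodA (w : Fin M.nA → ℝ) : IsBilin (prodA w : VA M pa → VA M pa → ℝ) := by
  refine IsBilin.sum _ fun K => IsBilin.integral (fun x => ?_)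
    fun u v => integrableOn_prodA (w K) K (u K) (v K)
  have hl : ∀ c : ℝ, IsLinearMap ℝ fun v : VA M pa => c * (v K).val x := fun c =>
    ⟨fun u v => by simp [Poly.val_add, mul_add], fun c v => by simp [Poly.val_smul]; ring⟩
  have := IsBilin.of_isLinearMap (hl (w K)) (hl 1) (LinearMap.mul ℝ ℝ)
  simpa using this

theorem prodA_comm (w : Fin M.nA → ℝ) (u v : VA M pa) : prodA w u v = prodA w v u := by
  simp only [prodA]
  refine Finset.sum_congr rfl fun K _ => integral_congr_ae (ae_of_all _ fun x => ?_)
  ring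

theorem isBilin_formAE {C : ℝ} (hR : M.Regular C) (hd : 1 ≤ d) (mat : Material M) (α : ℝ) :
    IsBilin (formAE mat α : VE M pe → VE M pe → ℝ) := by
  refine (((IsBilin.sum _ fun K => ?_).sub (IsBilin.sum _ fun F => ?_)).sub
    (IsBilin.sum _ fun F => ?_)).add (IsBilin.sum _ fun F => ?_)
  · have h1 : ∀ x, IsLinearMap ℝ fun v : VE M pe => mat.stress K (v K) x := fun x =>
      ⟨fun _ _ => (isLinearMap_stress mat K x).map_add _ _, fun _ _ => (isLinearMap_stress mat K x).map_smul _ _⟩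
    have h2 : ∀ x, IsLinearMap ℝ fun v : VE M pe => strain (v K) x := fun x =>
      ⟨fun _ _ => (isLinearMap_strain x).map_add _ _, fun _ _ => (isLinearMap_strain x).map_smul _ _⟩
    exact IsBilin.integral (fun x => IsBilin.dotProduct (h1 x) (h2 x))
      fun u v => M.integrableOn_cell
        ((continuous_stress mat K (u K)).dotProduct (continuous_strain (v K))) _
  · exact IsBilin.integral (fun x => IsBilin.dotProduct (isLinearMap_avgStress mat F x)
      (isLinearMap_jumpE F x)) fun u v => hR.integrableOn_face hd F
        ((continuous_avgStress mat u F).dotProduct (continuous_jumpE v F))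
  · exact IsBilin.integral (fun x => IsBilin.dotProduct (isLinearMap_jumpE F x)
      (isLinearMap_avgStress mat F x)) fun u v => hR.integrableOn_face hd F
        ((continuous_jumpE u F).dotProduct (continuous_avgStress mat v F))
  · exact IsBilin.integral (fun x => (IsBilin.dotProduct (isLinearMap_jumpE F x)
      (isLinearMap_jumpE F x)).const_mul _) fun u v => hR.integrableOn_face hd F
        (((continuous_jumpE u F).dotProduct (continuous_jumpE v F)).const_mul _)

theorem isBilin_formAA {C : ℝ} (hR : M.Regular C) (hd : 1 ≤ d) (mat : Material M) (β : ℝ) :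
    IsBilin (formAA mat β : VA M pa → VA M pa → ℝ) := by
  refine (((IsBilin.sum _ fun K => ?_).sub (IsBilin.sum _ fun F => ?_)).sub
    (IsBilin.sum _ fun F => ?_)).add (IsBilin.sum _ fun F => ?_)
  · refine IsBilin.integral (fun x => ?_)
      fun u v => M.integrableOn_cell
        (((continuous_grad (u K)).const_smul (mat.rhoA K)).inner (continuous_grad (v K))) _
    have hl : IsLinearMap ℝ fun v : VA M pa => grad (v K) x :=
      ⟨fun _ _ => (isLinearMap_grad x).map_add _ _, fun _ _ => (isLinearMap_grad x).map_smul _ _⟩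
    have := (IsBilin.inner hl hl).const_mul (mat.rhoA K)
    simpa only [real_inner_smul_left] using this
  · exact IsBilin.integral (fun x => IsBilin.inner (isLinearMap_avgFlux mat F x)
      (isLinearMap_jumpA F x)) fun u v => hR.integrableOn_face hd F
        ((continuous_avgFlux mat u F).inner (continuous_jumpA v F))
  · exact IsBilin.integral (fun x => IsBilin.inner (isLinearMap_jumpA F x)
      (isLinearMap_avgFlux mat F x)) fun u v => hR.integrableOn_face hd F
        ((continuous_jumpA u F).inner (continuous_avgFlux mat v F))
  · exact IsBilin.integral (fun x => (IsBilin.inner (isLinearMap_jumpA F x)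
      (isLinearMap_jumpA F x)).const_mul _) fun u v => hR.integrableOn_face hd F
        (((continuous_jumpA u F).inner (continuous_jumpA v F)).const_mul _)

theorem formAE_comm (mat : Material M) (α : ℝ) (u v : VE M pe) :
    formAE mat α u v = formAE mat α v u := by
  have h1 : ∀ K x, mat.stress K (u K) x ⬝ᵥ strain (v K) x =
      mat.stress K (v K) x ⬝ᵥ strain (u K) x := fun K x => mat.C_dotProduct_comm K _ _
  simp only [formAE, h1, dotProduct_comm (jumpE v _ _) (jumpE u _ _),
    dotProduct_comm (avgStress mat v _ _), dotProduct_comm (avgStress mat u _ _)]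
  ring

theorem formAA_comm (mat : Material M) (β : ℝ) (u v : VA M pa) :
    formAA mat β u v = formAA mat β v u := by
  simp only [formAA, real_inner_smul_left, real_inner_comm (jumpA v _ _) (jumpA u _ _),
    real_inner_comm (avgFlux mat v _ _), real_inner_comm (avgFlux mat u _ _),
    real_inner_comm (grad (v _) _) (grad (u _) _)]
  ring

/-- The interface terms cancel. -/
theorem formIE_add_formIA (hd : 2 ≤ d) (mat : Material M) (ψ : VA M pa) (v : VE M pe) :
    formIE mat ψ v + formIA mat v ψ = 0 := by
  simp only [formIE, formIA, ← Finset.sum_add_distrib]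
  refine Finset.sum_eq_zero fun F _ => Finset.sum_eq_zero fun Ke hKe =>
    Finset.sum_eq_zero fun Ka hKa => ?_
  have hKe' : M.IsFaceOf F (Sum.inl Ke) := by simpa [PolytopicMesh.adjE] using hKe
  have hKa' : M.IsFaceOf F (Sum.inr Ka) := by simpa [PolytopicMesh.adjA] using hKa
  rw [PolytopicMesh.normal_eq_neg hd (by simp) hKe' hKa', PolytopicMesh.faceIntegral,
    PolytopicMesh.faceIntegral, add_eq_zero_iff_eq_neg, ← integral_neg]
  refine integral_congr_ae (ae_of_all _ fun x => ?_)
  simp only [real_inner_smul_left, inner_neg_left]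
  rw [real_inner_comm]
  ring

end Forms


section Forms

variable {d : ℕ} {D : Domain d} {M : PolytopicMesh D} {pe : Fin M.nE → ℕ} {pa : Fin M.nA → ℕ}

/-! ### The stabilization functions -/

theorem PolytopicMesh.isFaceOf_of_mem_adjE {F : Fin M.nF} {K : Fin M.nE} (h : K ∈ M.adjE F) :
    M.IsFaceOf F (Sum.inl K) := by
  simpa [PolytopicMesh.adjE] using h

theorem PolytopicMesh.isFaceOf_of_mem_adjA {F : Fin M.nF} {K : Fin M.nA} (h : K ∈ M.adjA F) :
    M.IsFaceOf F (Sum.inr K) := by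
  simpa [PolytopicMesh.adjA] using h

theorem Material.le_eta (mat : Material M) {α : ℝ} (hα : 0 ≤ α) {F : Fin M.nF} {K : Fin M.nE}
    (h : K ∈ M.adjE F) :
    α * (mat.Cbar K * (pe K : ℝ) ^ 2 / M.diam (Sum.inl K)) ≤ mat.eta pe α F :=
  mul_le_mul_of_nonneg_left (le_ciSup
    (f := fun K : M.adjE F => mat.Cbar K.1 * (pe K.1 : ℝ) ^ 2 / M.diam (Sum.inl K.1))
    (finite_range _).bddAbove ⟨K, h⟩) hα

theorem Material.le_chi (mat : Material M) {β : ℝ} (hβ : 0 ≤ β) {F : Fin M.nF} {K : Fin M.nA}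
    (h : K ∈ M.adjA F) :
    β * (mat.rhoA K * (pa K : ℝ) ^ 2 / M.diam (Sum.inr K)) ≤ mat.chi pa β F :=
  mul_le_mul_of_nonneg_left (le_ciSup
    (f := fun K : M.adjA F => mat.rhoA K.1 * (pa K.1 : ℝ) ^ 2 / M.diam (Sum.inr K.1))
    (finite_range _).bddAbove ⟨K, h⟩) hβ

theorem Material.eta_pos (mat : Material M) (hd : 1 ≤ d) (hp : ∀ K, 1 ≤ pe K) {α : ℝ}
    (hα : 0 < α) {F : Fin M.nF} (hF : F ∈ M.facesE) : 0 < mat.eta pe α F := by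
  obtain ⟨K, hK⟩ := (Finset.mem_filter.1 hF).2.1
  refine lt_of_lt_of_le ?_ (mat.le_eta hα.le hK)
  have h1 := mat.Cbar_pos hd K
  have h2 := M.diam_pos hd (Sum.inl K)
  have h3 : (0 : ℝ) < pe K := by exact_mod_cast hp K
  positivity

theorem Material.chi_pos (mat : Material M) (hd : 1 ≤ d) (hp : ∀ K, 1 ≤ pa K) {β : ℝ}
    (hβ : 0 < β) {F : Fin M.nF} (hF : F ∈ M.facesA) : 0 < mat.chi pa β F := by
  obtain ⟨K, hK⟩ := (Finset.mem_filter.1 hF).2.1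
  refine lt_of_lt_of_le ?_ (mat.le_chi hβ.le hK)
  have h1 := mat.rhoA_pos K
  have h2 := M.diam_pos hd (Sum.inr K)
  have h3 : (0 : ℝ) < pa K := by exact_mod_cast hp K
  positivity

/-! ### Coercivity and continuity of the bilinear forms on the diagonal -/

theorem isPolyFun_sqrtC_strain (mat : Material M) (K : Fin M.nE) {p : ℕ} (v : Fin d → Poly d p)
    (i : Fin d × Fin d) : IsPolyFun p fun x => (mat.sqrtC K *ᵥ strain v x) i := by
  refine IsPolyFun.sum _ fun j => IsPolyFun.const_mul ?_ _
  have := (((v j.1).isPolyFun_partialVal j.2).add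
    ((v j.2).isPolyFun_partialVal j.1)).const_mul (1 / 2)
  have heq : (fun x => strain v x j) =
      fun x => 1 / 2 * ((v j.1).partialVal j.2 x + (v j.2).partialVal j.1 x) := by
    funext x
    simp only [strain]
    ring
  rwa [heq]

theorem dGSqE_eq (mat : Material M) {α : ℝ} (hη : ∀ F ∈ M.facesE, 0 ≤ mat.eta pe α F)
    (u : VE M pe) :
    dGSqE mat α u = (∑ K, ∫ x in M.cell (Sum.inl K),
        (mat.sqrtC K *ᵥ strain (u K) x) ⬝ᵥ (mat.sqrtC K *ᵥ strain (u K) x)) +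
      ∑ F ∈ M.facesE, mat.eta pe α F * M.faceIntegral F fun x => jumpE u F x ⬝ᵥ jumpE u F x := by
  rw [dGSqE]
  congr 1
  refine Finset.sum_congr rfl fun F hF => ?_
  rw [PolytopicMesh.faceIntegral, PolytopicMesh.faceIntegral, ← integral_const_mul]
  refine integral_congr_ae (ae_of_all _ fun x => ?_)
  simp only [smul_dotProduct, dotProduct_smul, smul_eq_mul]
  rw [← mul_assoc, Real.mul_self_sqrt (hη F hF)]

/-- On the diagonal the two consistency terms coincide, so the difference is minus twice their
common value. The bound yields coercivity with constant `1/2` and continuity with constant `3/2`. -/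
theorem abs_formAE_sub_le {C : ℝ} (hR : M.Regular C) (hC : 0 < C) (hd : 1 ≤ d)
    (hp : ∀ K, 1 ≤ pe K) (mat : Material M) {α : ℝ} (hα : 4 * (C * d * (d + 2) ^ 2) ≤ α)
    (u : VE M pe) :
    |formAE mat α u u - dGSqE mat α u| ≤ 1 / 2 * dGSqE mat α u := by
  have hd' : (1 : ℝ) ≤ d := by exact_mod_cast hd
  have hα0 : 0 < α := lt_of_lt_of_le (by positivity) hα
  have hη : ∀ F ∈ M.facesE, 0 < mat.eta pe α F := fun F hF => mat.eta_pos hd hp hα0 hF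
  have key := hR.consistency_le hC hd (e := Sum.inl) (adj := M.adjE)
    (fun F K hK => PolytopicMesh.isFaceOf_of_mem_adjE hK) M.facesE pe hp
    (fun K => mat.stress K (u K)) (fun K x => mat.sqrtC K *ᵥ strain (u K) x)
    (fun K => continuous_stress mat K (u K)) (fun K i => isPolyFun_sqrtC_strain mat K (u K) i)
    (jumpE u) (continuous_jumpE u) mat.Cbar (mat.Cbar_pos hd)
    (fun K x => mat.C_mulVec_sq_le K _) (mat.eta pe α) hα hη
    (fun F _ K hK => mat.le_eta hα0.le hK)
  rw [dGSqE_eq mat (fun F hF => (hη F hF).le)]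
  refine le_trans (le_of_eq ?_) key
  rw [← abs_two, ← abs_mul, ← abs_neg]
  congr 1
  have h1 : ∀ K x, mat.stress K (u K) x ⬝ᵥ strain (u K) x =
      (mat.sqrtC K *ᵥ strain (u K) x) ⬝ᵥ (mat.sqrtC K *ᵥ strain (u K) x) :=
    fun K x => (mat.sqrtC_dotProduct K _ _).symm
  simp only [formAE, h1, dotProduct_comm (jumpE u _ _) (avgStress mat u _ _)]
  simp only [PolytopicMesh.faceIntegral, integral_const_mul, avgStress]
  ring

theorem dGSqE_nonneg (mat : Material M) (α : ℝ) (u : VE M pe) : 0 ≤ dGSqE mat α u :=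
  add_nonneg
    (Finset.sum_nonneg fun _ _ => integral_nonneg fun _ => dotProduct_self_nonneg_real _)
    (Finset.sum_nonneg fun _ _ => integral_nonneg fun _ => dotProduct_self_nonneg_real _)

theorem norm_sq_eq_dotProduct (x : E d) : ‖x‖ ^ 2 = x.ofLp ⬝ᵥ x.ofLp := by
  rw [← real_inner_self_eq_norm_sq, inner_eq_dotProduct]

theorem dGSqA_eq (mat : Material M) {β : ℝ} (hχ : ∀ F ∈ M.facesA, 0 ≤ mat.chi pa β F)
    (ψ : VA M pa) :
    dGSqA mat β ψ = (∑ K, ∫ x in M.cell (Sum.inr K),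
        (Real.sqrt (mat.rhoA K) • grad (ψ K) x).ofLp ⬝ᵥ
          (Real.sqrt (mat.rhoA K) • grad (ψ K) x).ofLp) +
      ∑ F ∈ M.facesA, mat.chi pa β F *
        M.faceIntegral F fun x => (jumpA ψ F x).ofLp ⬝ᵥ (jumpA ψ F x).ofLp := by
  simp only [dGSqA, ← norm_sq_eq_dotProduct]
  congr 1
  refine Finset.sum_congr rfl fun F hF => ?_
  rw [PolytopicMesh.faceIntegral, PolytopicMesh.faceIntegral, ← integral_const_mul]
  refine integral_congr_ae (ae_of_all _ fun x => ?_)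
  simp only [norm_smul, mul_pow, Real.norm_eq_abs, sq_abs]
  rw [Real.sq_sqrt (hχ F hF)]

/-- As in the elastic case, with `a = ρ_a ∇ψ` and `S = ρ_a^{1/2} ∇ψ`; here `|a|² = ρ_a |S|²` is an
equality. -/
theorem abs_formAA_sub_le {C : ℝ} (hR : M.Regular C) (hC : 0 < C) (hd : 1 ≤ d)
    (hp : ∀ K, 1 ≤ pa K) (mat : Material M) {β : ℝ} (hβ : 4 * (C * d * (d + 2) ^ 2) ≤ β)
    (ψ : VA M pa) :
    |formAA mat β ψ ψ - dGSqA mat β ψ| ≤ 1 / 2 * dGSqA mat β ψ := by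
  have hd' : (1 : ℝ) ≤ d := by exact_mod_cast hd
  have hβ0 : 0 < β := lt_of_lt_of_le (by positivity) hβ
  have hχ : ∀ F ∈ M.facesA, 0 < mat.chi pa β F := fun F hF => mat.chi_pos hd hp hβ0 hF
  have key := hR.consistency_le hC hd (e := Sum.inr) (adj := M.adjA)
    (fun F K hK => PolytopicMesh.isFaceOf_of_mem_adjA hK) M.facesA pa hp
    (fun K x => (mat.rhoA K • grad (ψ K) x).ofLp)
    (fun K x => (Real.sqrt (mat.rhoA K) • grad (ψ K) x).ofLp)
    (fun K => continuous_pi fun i => ((ψ K).continuous_partialVal i).const_mul _)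
    (fun K i => ((ψ K).isPolyFun_partialVal i).const_mul _)
    (fun F x => (jumpA ψ F x).ofLp)
    (fun F => (PiLp.continuous_ofLp 2 _).comp (continuous_jumpA ψ F)) mat.rhoA mat.rhoA_pos
    (fun K x => le_of_eq ?_) (mat.chi pa β) hβ hχ
    (fun F _ K hK => mat.le_chi hβ0.le hK)
  · rw [dGSqA_eq mat (fun F hF => (hχ F hF).le)]
    refine le_trans (le_of_eq ?_) key
    rw [← abs_two, ← abs_mul, ← abs_neg]
    congr 1
    have h1 : ∀ K x, inner ℝ (mat.rhoA K • grad (ψ K) x) (grad (ψ K) x) =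
        (Real.sqrt (mat.rhoA K) • grad (ψ K) x).ofLp ⬝ᵥ
          (Real.sqrt (mat.rhoA K) • grad (ψ K) x).ofLp := by
      intro K x
      rw [← norm_sq_eq_dotProduct, norm_smul, mul_pow, Real.norm_eq_abs, sq_abs,
        Real.sq_sqrt (mat.rhoA_pos K).le, real_inner_smul_left, real_inner_self_eq_norm_sq]
    have h2 : ∀ F x, (avgFlux mat ψ F x).ofLp =
        ((M.adjA F).card : ℝ)⁻¹ • ∑ K ∈ M.adjA F, (mat.rhoA K • grad (ψ K) x).ofLp := by
      intro F x
      simp [avgFlux, WithLp.ofLp_sum]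
    simp only [formAA, h1, real_inner_comm (avgFlux mat ψ _ _) (jumpA ψ _ _)]
    simp only [inner_eq_dotProduct, h2, PolytopicMesh.faceIntegral, integral_const_mul]
    ring
  · rw [← norm_sq_eq_dotProduct, ← norm_sq_eq_dotProduct, norm_smul, norm_smul, mul_pow, mul_pow,
      Real.norm_eq_abs, Real.norm_eq_abs, sq_abs, sq_abs, Real.sq_sqrt (mat.rhoA_pos K).le]
    ring

theorem dGSqA_nonneg (mat : Material M) (β : ℝ) (ψ : VA M pa) : 0 ≤ dGSqA mat β ψ :=
  add_nonneg
    (Finset.sum_nonneg fun _ _ => integral_nonneg fun _ => sq_nonneg _)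
    (Finset.sum_nonneg fun _ _ => integral_nonneg fun _ => sq_nonneg _)

/-! ### The energy in terms of the weighted products -/

theorem ae_cell_rhoE (mat : Material M) (K : Fin M.nE) :
    ∀ᵐ x ∂volume.restrict (M.cell (Sum.inl K)), mat.rhoEMin ≤ mat.rhoE x :=
  (ae_restrict_of_ae_restrict_of_subset (M.cell_subset_Ωe K) mat.rhoE_bounds).mono
    fun _ h => h.1

theorem prodE_self_nonneg {w : E d → ℝ}
    (hw : ∀ K, ∀ᵐ x ∂volume.restrict (M.cell (Sum.inl K)), 0 ≤ w x) (v : VE M pe) :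
    0 ≤ prodE w v v := by
  refine Finset.sum_nonneg fun K _ => integral_nonneg_of_ae ?_
  filter_upwards [hw K] with x hx
  rw [real_inner_smul_left]
  exact mul_nonneg hx real_inner_self_nonneg

theorem prodA_self_nonneg {w : Fin M.nA → ℝ} (hw : ∀ K, 0 ≤ w K) (ψ : VA M pa) :
    0 ≤ prodA w ψ ψ :=
  Finset.sum_nonneg fun K _ => integral_nonneg fun x => by
    change 0 ≤ w K * (ψ K).val x * (ψ K).val x
    rw [mul_assoc]
    exact mul_nonneg (hw K) (mul_self_nonneg _)

theorem energySqE_eq (mat : Material M) (α : ℝ) (v v' : VE M pe) :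
    energySqE mat α v v' = prodE mat.rhoE v' v' +
      prodE (fun x => mat.rhoE x * mat.zeta x ^ 2) v v + dGSqE mat α v := by
  rw [energySqE, prodE, prodE]
  congr 2
  · refine Finset.sum_congr rfl fun K _ => integral_congr_ae ?_
    filter_upwards [ae_cell_rhoE mat K] with x hx
    rw [norm_smul, mul_pow, Real.norm_eq_abs, sq_abs, Real.sq_sqrt (mat.rhoEMin_pos.le.trans hx),
      real_inner_smul_left, real_inner_self_eq_norm_sq]
  · refine Finset.sum_congr rfl fun K _ => integral_congr_ae ?_
    filter_upwards [ae_cell_rhoE mat K] with x hx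
    rw [norm_smul, mul_pow, Real.norm_eq_abs, sq_abs, mul_pow,
      Real.sq_sqrt (mat.rhoEMin_pos.le.trans hx), real_inner_smul_left,
      real_inner_self_eq_norm_sq]

theorem energySqA_eq (mat : Material M) (β : ℝ) (ψ ψ' : VA M pa) :
    energySqA mat β ψ ψ' = prodA (fun K => (mat.c ^ 2)⁻¹ * mat.rhoA K) ψ' ψ' + dGSqA mat β ψ := by
  rw [energySqA, prodA]
  congr 1
  refine Finset.sum_congr rfl fun K _ => integral_congr_ae (ae_of_all _ fun x => ?_)
  simp only [mul_pow, Real.sq_sqrt (mat.rhoA_pos K).le]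
  ring

/-! ### Bounds of the loads -/

/-- The optimal parameter is `s = √G / a`; shifting numerator and denominator by a small `δ` keeps
it positive and finite when `G` or `a` vanishes. -/
theorem le_mul_sqrt_of_forall {X a G : ℝ} (ha : 0 ≤ a) (hG : 0 ≤ G)
    (h : ∀ s > 0, 2 * X ≤ s * a ^ 2 + s⁻¹ * G) : X ≤ a * √G := by
  refine le_of_forall_pos_le_add fun ε hε => ?_
  have hδ : ∃ δ > 0, δ * (a + √G) ≤ ε := by
    refine ⟨ε / (a + √G + 1), by positivity, ?_⟩
    rw [div_mul_eq_mul_div, div_le_iff₀ (by positivity)]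
    nlinarith [Real.sqrt_nonneg G]
  obtain ⟨δ, hδ, hδε⟩ := hδ
  have hg := Real.sqrt_nonneg G
  have h1 := h ((√G + δ) / (a + δ)) (by positivity)
  have h2 : (√G + δ) / (a + δ) * a ^ 2 ≤ (√G + δ) * a := by
    rw [div_mul_eq_mul_div, div_le_iff₀ (by positivity)]
    nlinarith [mul_nonneg (mul_nonneg (by positivity : 0 ≤ √G + δ) ha) hδ.le]
  have h3 : ((√G + δ) / (a + δ))⁻¹ * G ≤ (a + δ) * √G := by
    rw [inv_div, div_mul_eq_mul_div, div_le_iff₀ (by positivity)]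
    nlinarith [Real.sq_sqrt hG, mul_nonneg (mul_nonneg (by positivity : 0 ≤ a + δ) hg) hδ.le]
  nlinarith

/-- The Cauchy-Schwarz inequality for a load. -/
theorem PolytopicMesh.sum_integral_le {κ W : Type*} [Fintype κ] [NormedAddCommGroup W]
    [InnerProductSpace ℝ W] {Ω : Set (E d)} (f : Lp W 2 (volume.restrict Ω))
    (e : κ → Fin M.nE ⊕ Fin M.nA) (he : Function.Injective e) (hsub : ∀ K, M.cell (e K) ⊆ Ω)
    (h g : κ → E d → ℝ) (hg : ∀ K, Continuous (g K))
    (hb : ∀ K x, |h K x| ≤ ‖f x‖ * |g K x|) :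
    ∑ K, ∫ x in M.cell (e K), h K x ≤ ‖f‖ * √(∑ K, ∫ x in M.cell (e K), g K x ^ 2) := by
  have hfi : Integrable (fun x => ‖f x‖ ^ 2) (volume.restrict Ω) := by
    have := L2.integrable_inner (𝕜 := ℝ) f f
    simpa only [real_inner_self_eq_norm_sq] using this
  have hfn : ∫ x in Ω, ‖f x‖ ^ 2 = ‖f‖ ^ 2 := by
    have := L2.inner_def (𝕜 := ℝ) f f
    rw [real_inner_self_eq_norm_sq] at this
    rw [this]
    simp only [real_inner_self_eq_norm_sq]
  have hfs : ∑ K, ∫ x in M.cell (e K), ‖f x‖ ^ 2 ≤ ‖f‖ ^ 2 := by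
    rw [← hfn, ← integral_biUnion_finset (s := fun K => M.cell (e K)) Finset.univ
      (fun K _ => (M.isOpen_cell _).measurableSet)
      (fun K _ L _ hKL => M.disjoint_cell _ _ fun h => hKL (he h))
      (fun K _ => IntegrableOn.mono_set hfi (hsub K))]
    exact setIntegral_mono_set hfi (ae_of_all _ fun x => sq_nonneg _)
      (iUnion₂_subset fun K _ => hsub K).eventuallyLE
  refine le_mul_sqrt_of_forall (norm_nonneg f)
    (Finset.sum_nonneg fun K _ => integral_nonneg fun x => sq_nonneg _) fun s hs => ?_
  have hone : ∀ K, 2 * ∫ x in M.cell (e K), h K x ≤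
      s * (∫ x in M.cell (e K), ‖f x‖ ^ 2) + s⁻¹ * ∫ x in M.cell (e K), g K x ^ 2 := by
    intro K
    have hfK : IntegrableOn (fun x => ‖f x‖ ^ 2) (M.cell (e K)) := IntegrableOn.mono_set hfi (hsub K)
    have hgK : IntegrableOn (fun x => g K x ^ 2) (M.cell (e K)) :=
      M.integrableOn_cell ((hg K).pow 2) (e K)
    rw [← integral_const_mul, ← integral_const_mul, ← integral_const_mul,
      ← integral_add (hfK.const_mul s) (hgK.const_mul s⁻¹)]
    -- Only the dominating function has to be integrable, so no measurability of `h` is needed.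
    refine (Real.le_norm_self _).trans (norm_integral_le_of_norm_le
      ((hfK.const_mul s).add (hgK.const_mul s⁻¹)) (ae_of_all _ fun x => ?_))
    rw [Real.norm_eq_abs, abs_mul, abs_two]
    have h1 := hb K x
    have h2 : 0 ≤ s⁻¹ * (s * ‖f x‖ - |g K x|) ^ 2 := by positivity
    have h3 : s⁻¹ * (s * ‖f x‖ - |g K x|) ^ 2 =
        s * ‖f x‖ ^ 2 + s⁻¹ * g K x ^ 2 - 2 * (‖f x‖ * |g K x|) := by
      rw [← sq_abs (g K x)]
      field_simp
      ring
    linarith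
  rw [Finset.mul_sum]
  refine (Finset.sum_le_sum fun K _ => hone K).trans ?_
  rw [Finset.sum_add_distrib, ← Finset.mul_sum, ← Finset.mul_sum]
  gcongr

theorem load_E_le (mat : Material M) {r : ℝ} (hr : 0 < r) (hrho : r ≤ mat.rhoEMin)
    (f : Lp (E d) 2 (volume.restrict D.Ωe)) (v : VE M pe) :
    ∑ K, ∫ x in M.cell (Sum.inl K), inner ℝ (f x) (vecVal (v K) x) ≤
      (√r)⁻¹ * ‖f‖ * √(prodE mat.rhoE v v) := by
  have h := M.sum_integral_le f Sum.inl Sum.inl_injective M.cell_subset_Ωe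
    (fun K x => inner ℝ (f x) (vecVal (v K) x)) (fun K x => ‖vecVal (v K) x‖)
    (fun K => (continuous_vecVal (v K)).norm) fun K x => by
      rw [abs_norm]; exact abs_real_inner_le_norm _ _
  refine h.trans ?_
  have hle : ∑ K, ∫ x in M.cell (Sum.inl K), ‖vecVal (v K) x‖ ^ 2 ≤
      r⁻¹ * prodE mat.rhoE v v := by
    rw [prodE, Finset.mul_sum]
    refine Finset.sum_le_sum fun K _ => ?_
    rw [← integral_const_mul]
    refine integral_mono_ae (M.integrableOn_cell ((continuous_vecVal (v K)).norm.pow 2) _)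
      ((integrableOn_prodE mat.isBoundedWeight_rhoE K (v K) (v K)).const_mul _) ?_
    filter_upwards [ae_cell_rhoE mat K] with x hx
    rw [real_inner_smul_left, real_inner_self_eq_norm_sq, ← mul_assoc]
    refine le_mul_of_one_le_left (sq_nonneg _) ?_
    rw [inv_mul_eq_div, one_le_div hr]
    exact hrho.trans hx
  calc ‖f‖ * √(∑ K, ∫ x in M.cell (Sum.inl K), ‖vecVal (v K) x‖ ^ 2)
      ≤ ‖f‖ * √(r⁻¹ * prodE mat.rhoE v v) := by gcongr
    _ = _ := by
      rw [Real.sqrt_mul (inv_nonneg.2 hr.le), Real.sqrt_inv]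
      ring

theorem load_A_le (mat : Material M) {r c : ℝ} (hrho : mat.rhoAMax ≤ r)
    (hc : mat.c ≤ c) (f : Lp ℝ 2 (volume.restrict D.Ωa)) (ψ : VA M pa) :
    ∑ K, ∫ x in M.cell (Sum.inr K), (mat.rhoA K * f x) * (ψ K).val x ≤
      √r * c * ‖f‖ * √(prodA (fun K => (mat.c ^ 2)⁻¹ * mat.rhoA K) ψ ψ) := by
  have h := M.sum_integral_le f Sum.inr Sum.inr_injective M.cell_subset_Ωa
    (fun K x => (mat.rhoA K * f x) * (ψ K).val x) (fun K x => mat.rhoA K * (ψ K).val x)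
    (fun K => (ψ K).continuous_val.const_mul _) fun K x => by
      rw [Real.norm_eq_abs, ← abs_mul]
      exact le_of_eq (congrArg abs (by ring))
  refine h.trans ?_
  have hc0 : 0 < c := mat.c_pos.trans_le hc
  -- Positivity of `r` comes from the density of some acoustic element; with no such element both
  -- sums are empty.
  rcases isEmpty_or_nonempty (Fin M.nA) with hE | ⟨⟨K₀⟩⟩
  · simp [prodA]
  have hr : 0 < r := (mat.rhoA_pos K₀).trans_le ((mat.rhoA_bounds K₀).2.trans hrho)
  have hle : ∑ K, ∫ x in M.cell (Sum.inr K), (mat.rhoA K * (ψ K).val x) ^ 2 ≤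
      r * c ^ 2 * prodA (fun K => (mat.c ^ 2)⁻¹ * mat.rhoA K) ψ ψ := by
    rw [prodA, Finset.mul_sum]
    refine Finset.sum_le_sum fun K _ => ?_
    rw [← integral_const_mul]
    refine integral_mono (M.integrableOn_cell (((ψ K).continuous_val.const_mul _).pow 2) _)
      ((integrableOn_prodA _ K (ψ K) (ψ K)).const_mul _) fun x => ?_
    have h1 : mat.rhoA K ≤ r := (mat.rhoA_bounds K).2.trans hrho
    have h2 : 1 ≤ c ^ 2 * (mat.c ^ 2)⁻¹ := by
      rw [← div_eq_mul_inv, one_le_div (pow_pos mat.c_pos 2)]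
      exact pow_le_pow_left₀ mat.c_pos.le hc 2
    have h3 := mat.rhoA_pos K
    have h4 : mat.rhoA K ≤ r * (c ^ 2 * (mat.c ^ 2)⁻¹) := by nlinarith
    calc (mat.rhoA K * (ψ K).val x) ^ 2 = mat.rhoA K * (mat.rhoA K * (ψ K).val x ^ 2) := by ring
      _ ≤ r * (c ^ 2 * (mat.c ^ 2)⁻¹) * (mat.rhoA K * (ψ K).val x ^ 2) := by gcongr
      _ = _ := by ring
  calc ‖f‖ * √(∑ K, ∫ x in M.cell (Sum.inr K), (mat.rhoA K * (ψ K).val x) ^ 2)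
      ≤ ‖f‖ * √(r * c ^ 2 * prodA (fun K => (mat.c ^ 2)⁻¹ * mat.rhoA K) ψ ψ) := by gcongr
    _ = _ := by
      rw [Real.sqrt_mul (by positivity), Real.sqrt_mul hr.le, Real.sqrt_sq hc0.le]
      ring

end Forms


/-! ### A Gronwall inequality for square roots -/

theorem sqrt_le_of_deriv_le {T C : ℝ} (hC : 0 ≤ C) {y y' g : ℝ → ℝ}
    (hy : ∀ t ∈ Icc 0 T, HasDerivWithinAt y (y' t) (Icc 0 T) t) (hy0 : ∀ t ∈ Icc 0 T, 0 ≤ y t)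
    (hg : ContinuousOn g (Icc 0 T)) (hg0 : ∀ t, 0 ≤ g t)
    (h : ∀ t ∈ Ioc 0 T, y' t ≤ 2 * (C * g t) * √(y t)) {t : ℝ} (ht : t ∈ Icc 0 T) :
    √(y t) ≤ √(y 0) + C * ∫ τ in (0 : ℝ)..t, g τ := by
  have hT : 0 ≤ T := ht.1.trans ht.2
  refine le_of_forall_pos_le_add fun ε hε => ?_
  -- The shift by `ε²` makes the square root differentiable where `y` vanishes. The differential
  -- inequality says that `H` is nonincreasing, and the shift costs at most `ε` at time `0`.
  set H : ℝ → ℝ := fun t => √(y t + ε ^ 2) - C * ∫ τ in (0 : ℝ)..t, g τ with hH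
  have hpos : ∀ t ∈ Icc 0 T, 0 < y t + ε ^ 2 := fun t ht =>
    add_pos_of_nonneg_of_pos (hy0 t ht) (by positivity)
  have hcont : ContinuousOn H (Icc 0 T) := by
    refine ContinuousOn.sub ?_ ?_
    · have hyc : ContinuousOn y (Icc 0 T) := fun t ht => (hy t ht).continuousWithinAt
      exact Real.continuous_sqrt.comp_continuousOn (hyc.add continuousOn_const)
    · have := intervalIntegral.continuousOn_primitive_interval (μ := volume) (f := g) (a := 0)
        (b := T) (by rw [uIcc_of_le hT]; exact hg.integrableOn_compact isCompact_Icc)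
      rw [uIcc_of_le hT] at this
      exact continuousOn_const.mul this
  have hderiv : ∀ t ∈ Ioo 0 T,
      HasDerivAt H (y' t / (2 * √(y t + ε ^ 2)) - C * g t) t := by
    intro t ht
    have hnhds : Icc 0 T ∈ 𝓝 t := Icc_mem_nhds ht.1 ht.2
    have htI : t ∈ Icc 0 T := Ioo_subset_Icc_self ht
    have h1 : HasDerivAt y (y' t) t := (hy t htI).hasDerivAt hnhds
    have h2 : HasDerivAt (fun t => ∫ τ in (0 : ℝ)..t, g τ) (g t) t := by
      refine intervalIntegral.integral_hasDerivAt_right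
        (ContinuousOn.intervalIntegrable_of_Icc ht.1.le
          (hg.mono (Icc_subset_Icc_right ht.2.le)))
        ⟨Icc 0 T, hnhds, hg.aestronglyMeasurable measurableSet_Icc⟩ (hg.continuousAt hnhds)
    exact ((h1.add_const (ε ^ 2)).sqrt (hpos t htI).ne').sub (h2.const_mul C)
  have hanti : AntitoneOn H (Icc 0 T) := by
    refine antitoneOn_of_deriv_nonpos (convex_Icc 0 T) hcont ?_ ?_
    · rw [interior_Icc]
      exact fun t ht => (hderiv t ht).differentiableAt.differentiableWithinAt
    · rw [interior_Icc]
      intro t ht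
      rw [(hderiv t ht).deriv]
      have htI : t ∈ Icc 0 T := Ioo_subset_Icc_self ht
      have hs : 0 < √(y t + ε ^ 2) := Real.sqrt_pos.2 (hpos t htI)
      have h1 := h t (Ioo_subset_Ioc_self ht)
      have h2 : √(y t) ≤ √(y t + ε ^ 2) := Real.sqrt_le_sqrt (by nlinarith)
      have h3 : 0 ≤ C * g t := mul_nonneg hC (hg0 t)
      rw [sub_nonpos, div_le_iff₀ (by positivity)]
      nlinarith
  have h0T : (0 : ℝ) ∈ Icc 0 T := ⟨le_rfl, hT⟩
  have h1 := hanti h0T ht ht.1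
  have h2 : √(y t) ≤ √(y t + ε ^ 2) := Real.sqrt_le_sqrt (by nlinarith)
  have h3 : √(y 0 + ε ^ 2) ≤ √(y 0) + ε := by
    refine Real.sqrt_le_iff.2 ⟨by positivity, ?_⟩
    nlinarith [Real.sq_sqrt (hy0 0 h0T), Real.sqrt_nonneg (y 0)]
  simp only [hH, intervalIntegral.integral_same, mul_zero, sub_zero] at h1
  linarith

/-! ### The modified energy: equivalence with the energy norm, and the energy estimate -/

section Energy

variable {d : ℕ} {D : Domain d} {M : PolytopicMesh D} {pe : Fin M.nE → ℕ} {pa : Fin M.nA → ℕ}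

/-- Twice the conserved energy of the semi-discrete problem. -/
def modifiedEnergy (mat : Material M) (α β : ℝ) (v v' : VE M pe) (ψ ψ' : VA M pa) : ℝ :=
  prodE mat.rhoE v' v' + prodE (fun x => mat.rhoE x * mat.zeta x ^ 2) v v + formAE mat α v v +
    prodA (fun K => (mat.c ^ 2)⁻¹ * mat.rhoA K) ψ' ψ' + formAA mat β ψ ψ

theorem isBoundedWeight_rhoE_zeta_sq (mat : Material M) :
    IsBoundedWeight D.Ωe fun x => mat.rhoE x * mat.zeta x ^ 2 := by
  simpa only [sq] using mat.isBoundedWeight_rhoE.mul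
    (mat.isBoundedWeight_zeta.mul mat.isBoundedWeight_zeta)

theorem ae_cell_zeta (mat : Material M) (K : Fin M.nE) :
    ∀ᵐ x ∂volume.restrict (M.cell (Sum.inl K)), 0 ≤ mat.zeta x := by
  obtain ⟨B, hB⟩ := mat.zeta_bounds
  exact (ae_restrict_of_ae_restrict_of_subset ((M.cell_subset_Ωe K).trans D.Ωe_subset) hB).mono
    fun _ h => h.1

/-- The modified energy is equivalent to the square of the energy norm. -/
theorem modifiedEnergy_bounds {C : ℝ} (hR : M.Regular C) (hC : 0 < C) (hd : 1 ≤ d)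
    (hpe : ∀ K, 1 ≤ pe K) (hpa : ∀ K, 1 ≤ pa K) (mat : Material M) {α β : ℝ}
    (hα : 4 * (C * d * (d + 2) ^ 2) ≤ α) (hβ : 4 * (C * d * (d + 2) ^ 2) ≤ β)
    (v v' : VE M pe) (ψ ψ' : VA M pa) :
    prodE mat.rhoE v' v' ≤ modifiedEnergy mat α β v v' ψ ψ' ∧
    prodA (fun K => (mat.c ^ 2)⁻¹ * mat.rhoA K) ψ' ψ' ≤ modifiedEnergy mat α β v v' ψ ψ' ∧
    energySqE mat α v v' + energySqA mat β ψ ψ' ≤ 2 * modifiedEnergy mat α β v v' ψ ψ' ∧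
    modifiedEnergy mat α β v v' ψ ψ' ≤ 2 * (energySqE mat α v v' + energySqA mat β ψ ψ') := by
  have h1 := abs_le.1 (abs_formAE_sub_le hR hC hd hpe mat hα v)
  have h2 := abs_le.1 (abs_formAA_sub_le hR hC hd hpa mat hβ ψ)
  have h3 := dGSqE_nonneg mat α v
  have h4 := dGSqA_nonneg mat β ψ
  have h5 : 0 ≤ prodE mat.rhoE v' v' := prodE_self_nonneg (fun K => by
    filter_upwards [ae_cell_rhoE mat K] with x hx using mat.rhoEMin_pos.le.trans hx) _
  have h6 : 0 ≤ prodE (fun x => mat.rhoE x * mat.zeta x ^ 2) v v :=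
    prodE_self_nonneg (fun K => by
      filter_upwards [ae_cell_rhoE mat K] with x hx
      exact mul_nonneg (mat.rhoEMin_pos.le.trans hx) (sq_nonneg _)) _
  have h7 : 0 ≤ prodA (fun K => (mat.c ^ 2)⁻¹ * mat.rhoA K) ψ' ψ' :=
    prodA_self_nonneg (fun K => mul_nonneg (by positivity) (mat.rhoA_pos K).le) _
  rw [energySqE_eq, energySqA_eq, modifiedEnergy]
  refine ⟨?_, ?_, ?_, ?_⟩ <;> linarith [h1.1, h1.2, h2.1, h2.2]

/-- The derivative of the modified energy along a path. -/
theorem hasDerivWithinAt_modifiedEnergy {C : ℝ} (hR : M.Regular C) (hd : 1 ≤ d)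
    (mat : Material M) (α β : ℝ) {T : ℝ} {u u' u'' : ℝ → VE M pe} {φ φ' φ'' : ℝ → VA M pa}
    (hu : IsC2Path T u u' u'') (hφ : IsC2Path T φ φ' φ'') {t : ℝ} (ht : t ∈ Icc 0 T) :
    HasDerivWithinAt (fun s => modifiedEnergy mat α β (u s) (u' s) (φ s) (φ' s))
      (2 * prodE mat.rhoE (u' t) (u'' t) +
        2 * prodE (fun x => mat.rhoE x * mat.zeta x ^ 2) (u t) (u' t) +
        2 * formAE mat α (u t) (u' t) +
        2 * prodA (fun K => (mat.c ^ 2)⁻¹ * mat.rhoA K) (φ' t) (φ'' t) +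
        2 * formAA mat β (φ t) (φ' t)) (Icc 0 T) t := by
  have h1 := (isBilin_prodE (pe := pe) mat.isBoundedWeight_rhoE).hasDerivWithinAt_self
    (prodE_comm _) fun ℓ => hu.hasDeriv₂ ℓ t ht
  have h2 := (isBilin_prodE (pe := pe) (isBoundedWeight_rhoE_zeta_sq mat)).hasDerivWithinAt_self
    (prodE_comm _) fun ℓ => hu.hasDeriv₁ ℓ t ht
  have h3 := (isBilin_formAE (pe := pe) hR hd mat α).hasDerivWithinAt_self
    (formAE_comm mat α) fun ℓ => hu.hasDeriv₁ ℓ t ht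
  have h4 := (isBilin_prodA (pa := pa)
    fun K => (mat.c ^ 2)⁻¹ * mat.rhoA K).hasDerivWithinAt_self
    (prodA_comm _) fun ℓ => hφ.hasDeriv₂ ℓ t ht
  have h5 := (isBilin_formAA (pa := pa) hR hd mat β).hasDerivWithinAt_self
    (formAA_comm mat β) fun ℓ => hφ.hasDeriv₁ ℓ t ht
  exact (((h1.add h2).add h3).add h4).add h5

/-- The energy estimate in the modified energy. -/
theorem sqrt_modifiedEnergy_le {C : ℝ} (hR : M.Regular C) (hC : 0 < C) (hd : 2 ≤ d)
    (hpe : ∀ K, 1 ≤ pe K) (hpa : ∀ K, 1 ≤ pa K) (mat : Material M) {α β : ℝ}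
    (hα : 4 * (C * d * (d + 2) ^ 2) ≤ α) (hβ : 4 * (C * d * (d + 2) ^ 2) ≤ β)
    {r₀ r₁ c : ℝ} (hr₀ : 0 < r₀) (hr : r₀ ≤ mat.rhoEMin) (hr₁ : mat.rhoAMax ≤ r₁)
    (hc : mat.c ≤ c) {T : ℝ}
    {fe : ℝ → Lp (E d) 2 (volume.restrict D.Ωe)} {fa : ℝ → Lp ℝ 2 (volume.restrict D.Ωa)}
    (hfe : ContinuousOn fe (Icc 0 T)) (hfa : ContinuousOn fa (Icc 0 T))
    {u u' u'' : ℝ → VE M pe} {φ φ' φ'' : ℝ → VA M pa}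
    (h : IsSemidiscreteSolution mat α β T fe fa u u' u'' φ φ' φ'') {t : ℝ} (ht : t ∈ Icc 0 T) :
    √(modifiedEnergy mat α β (u t) (u' t) (φ t) (φ' t)) ≤
      √(modifiedEnergy mat α β (u 0) (u' 0) (φ 0) (φ' 0)) +
        ((√r₀)⁻¹ + √r₁ * c) * ∫ τ in (0 : ℝ)..t, (‖fe τ‖ + ‖fa τ‖) := by
  have hd1 : 1 ≤ d := by omega
  have hc0 : 0 ≤ c := mat.c_pos.le.trans hc
  have hbd := fun s => modifiedEnergy_bounds hR hC hd1 hpe hpa mat hα hβ (u s) (u' s) (φ s) (φ' s)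
  have hnn : ∀ v : VE M pe, 0 ≤ prodE mat.rhoE v v := fun v => prodE_self_nonneg (fun K => by
    filter_upwards [ae_cell_rhoE mat K] with x hx using mat.rhoEMin_pos.le.trans hx) _
  refine sqrt_le_of_deriv_le (T := T) (C := (√r₀)⁻¹ + √r₁ * c)
    (y := fun s => modifiedEnergy mat α β (u s) (u' s) (φ s) (φ' s))
    (g := fun s => ‖fe s‖ + ‖fa s‖) (by positivity)
    (fun s hs => hasDerivWithinAt_modifiedEnergy hR hd1 mat α β h.u_path h.φ_path hs)
    (fun s _ => (hnn _).trans (hbd s).1) (hfe.norm.add hfa.norm) (fun s => by positivity)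
    (fun s hs => ?_) ht
  -- Testing with the velocities makes every symmetric term half of its time derivative.
  have heq := h.equation s hs (u' s) (φ' s)
  have hint := formIE_add_formIA hd mat (φ' s) (u' s)
  have hdamp : 0 ≤ prodE (fun x => 2 * mat.rhoE x * mat.zeta x) (u' s) (u' s) :=
    prodE_self_nonneg (fun K => by
      filter_upwards [ae_cell_rhoE mat K, ae_cell_zeta mat K] with x hx hz
      have := mat.rhoEMin_pos.le.trans hx
      positivity) _
  have hE := load_E_le mat hr₀ hr (fe s) (u' s)
  have hA := load_A_le mat hr₁ hc (fa s) (φ' s)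
  set Y := modifiedEnergy mat α β (u s) (u' s) (φ s) (φ' s) with hY
  have hE' : (√r₀)⁻¹ * ‖fe s‖ * √(prodE mat.rhoE (u' s) (u' s)) ≤ (√r₀)⁻¹ * ‖fe s‖ * √Y := by
    gcongr
    exact (hbd s).1
  have hA' : √r₁ * c * ‖fa s‖ *
      √(prodA (fun K => (mat.c ^ 2)⁻¹ * mat.rhoA K) (φ' s) (φ' s)) ≤
        √r₁ * c * ‖fa s‖ * √Y := by
    gcongr
    exact (hbd s).2.1
  -- The nonnegative cross terms are added so that a single constant multiplies `‖f_e‖ + ‖f_a‖`.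
  have h1 : 0 ≤ (√r₀)⁻¹ * ‖fa s‖ * √Y := by positivity
  have h2 : 0 ≤ √r₁ * c * ‖fe s‖ * √Y := by positivity
  rw [prodE_comm mat.rhoE (u'' s), prodA_comm _ (φ'' s)] at heq
  have h3 : 2 * (((√r₀)⁻¹ + √r₁ * c) * (‖fe s‖ + ‖fa s‖)) * √Y =
      2 * ((√r₀)⁻¹ * ‖fe s‖ * √Y + √r₁ * c * ‖fa s‖ * √Y + (√r₀)⁻¹ * ‖fa s‖ * √Y +
        √r₁ * c * ‖fe s‖ * √Y) := by ring
  rw [h3]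
  linarith

end Energy

end
end ElastoAcoustic

/-! ### The stability theorem -/

open ElastoAcoustic
theorem theorem2 (d : ℕ) (hd : d = 2 ∨ d = 3) (Cmesh : ℝ) (hCmesh : 0 < Cmesh) :
    ∃ α₀ > (0 : ℝ), ∃ β₀ > (0 : ℝ),
      ∀ rho₀ rho₁ c₁ : ℝ, 0 < rho₀ → 0 < rho₁ → 0 < c₁ → ∃ Cstab > (0 : ℝ),
        ∀ (D : Domain d) (M : PolytopicMesh D), M.Regular Cmesh →
        ∀ mat : Material M, rho₀ ≤ mat.rhoEMin → mat.rhoAMax ≤ rho₁ → mat.c ≤ c₁ →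
        ∀ (pe : Fin M.nE → ℕ) (pa : Fin M.nA → ℕ), (∀ K, 1 ≤ pe K) → (∀ K, 1 ≤ pa K) →
        ∀ α ≥ α₀, ∀ β ≥ β₀, ∀ T > (0 : ℝ),
        ∀ (fe : ℝ → Lp (E d) 2 (volume.restrict D.Ωe))
          (fa : ℝ → Lp ℝ 2 (volume.restrict D.Ωa)),
        ContinuousOn fe (Icc 0 T) → ContinuousOn fa (Icc 0 T) →
        ∀ (u u' u'' : ℝ → VE M pe) (φ φ' φ'' : ℝ → VA M pa),
        IsSemidiscreteSolution mat α β T fe fa u u' u'' φ φ' φ'' →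
        ∀ t ∈ Ioc 0 T,
          energyNorm mat α β (u t) (u' t) (φ t) (φ' t) ≤
            Cstab * (energyNorm mat α β (u 0) (u' 0) (φ 0) (φ' 0)
              + ∫ τ in (0 : ℝ)..t, (‖fe τ‖ + ‖fa τ‖)) := by
  have hd2 : 2 ≤ d := by omega
  have hd0 : (0 : ℝ) < d := by exact_mod_cast (by omega : 0 < d)
  -- The threshold is four times the trace-inverse constant. Each passage between the energy norm
  -- and the root of the modified energy costs `√2`: twice for the initial value, giving `2`, and
  -- once for the loads.
  refine ⟨4 * (Cmesh * d * (d + 2) ^ 2), by positivity, 4 * (Cmesh * d * (d + 2) ^ 2),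
    by positivity, fun rho₀ rho₁ c₁ h₀ h₁ hc₁ =>
    ⟨2 + √2 * ((√rho₀)⁻¹ + √rho₁ * c₁), by positivity, ?_⟩⟩
  intro D M hR mat hr₀ hr₁ hc pe pa hpe hpa α hα β hβ T hT fe fa hfe hfa u u' u'' φ φ' φ'' hsol t ht
  have hmain := sqrt_modifiedEnergy_le hR hCmesh hd2 hpe hpa mat hα hβ h₀ hr₀ hr₁ hc hfe hfa hsol
    (Ioc_subset_Icc_self ht)
  have hbd := fun s => modifiedEnergy_bounds hR hCmesh (by omega) hpe hpa mat hα hβ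
    (u s) (u' s) (φ s) (φ' s)
  set I := ∫ τ in (0 : ℝ)..t, (‖fe τ‖ + ‖fa τ‖)
  have hI : 0 ≤ I := intervalIntegral.integral_nonneg ht.1.le fun τ _ => by positivity
  set c₂ := (√rho₀)⁻¹ + √rho₁ * c₁
  have hc₂ : 0 ≤ c₂ := by positivity
  have h2 : √2 * √2 = (2 : ℝ) := Real.mul_self_sqrt zero_le_two
  have hs2 := Real.sqrt_nonneg 2
  set Nt := energyNorm mat α β (u t) (u' t) (φ t) (φ' t) with hNt
  set N0 := energyNorm mat α β (u 0) (u' 0) (φ 0) (φ' 0) with hN0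
  have hN0nn : 0 ≤ N0 := Real.sqrt_nonneg _
  set Yt := modifiedEnergy mat α β (u t) (u' t) (φ t) (φ' t)
  set Y0 := modifiedEnergy mat α β (u 0) (u' 0) (φ 0) (φ' 0)
  have hle1 : Nt ≤ √2 * √Yt := by
    rw [hNt, energyNorm, ← Real.sqrt_mul zero_le_two]
    exact Real.sqrt_le_sqrt (hbd t).2.2.1
  have hle2 : √Y0 ≤ √2 * N0 := by
    rw [hN0, energyNorm, ← Real.sqrt_mul zero_le_two]
    exact Real.sqrt_le_sqrt (hbd 0).2.2.2
  calc Nt ≤ √2 * √Yt := hle1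
    _ ≤ √2 * (√2 * N0 + c₂ * I) := by gcongr; linarith
    _ = 2 * N0 + √2 * c₂ * I := by rw [mul_add, ← mul_assoc, h2]; ring
    _ ≤ (2 + √2 * c₂) * (N0 + I) := by
      have : 0 ≤ √2 * c₂ * N0 := by positivity
      linarith
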